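/- Let $Q$ be a smooth (Hausdorff, second countable) $n$-dimensional manifold with a smooth Riemannian metric $\langle\!\langle\cdot,\cdot\rangle\!\rangle$ (the kinetic energy), and let $D\subset TQ$ be a smooth vector subbundle of rank $r$. Let $i_D:D\hookrightarrow TQ$ be the inclusion and $\mathcal P:TQ\to D$ the projection of the orthogonal decomposition $TQ=D\oplus D^\perp$; dualizing, one has $i_D^*:T^*Q\to D^*$ (restriction of covectors) and $\mathcal P^*:D^*\to T^*Q$. The nonholonomic (almost Poisson) bracket of $\varphi,\psi\in C^\infty(D^*)$ is the function on $D^*$ $$\{\varphi,\psi\}_{D^*}:=\{\varphi\circ i_D^*,\ \psi\circ i_D^*\}_{T^*Q}\circ\mathcal P^*,$$ where $\{\cdot,\cdot\}_{T^*Q}$ is the canonical Poisson bracket, $\{F,G\}_{T^*Q}=\sum_a\left(\frac{\partial F}{\partial q^a}\frac{\partial G}{\partial p_a}-\frac{\partial F}{\partial p_a}\frac{\partial G}{\partial q^a}\right)$ in canonical coordinates $(q^a,p_a)$ of $T^*Q$. **Theorem.** The bracket $\{\cdot,\cdot\}_{D^*}$ satisfies the Jacobi identity $$\{\{\varphi,\psi\}_{D^*},\mu\}_{D^*}+\{\{\mu,\varphi\}_{D^*},\psi\}_{D^*}+\{\{\psi,\mu\}_{D^*},\varphi\}_{D^*}=0\qquad\text{for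 all }\varphi,\psi,\mu\in C^\infty(D^*)$$ if and only if the distribution $D$ is integrable, i.e. through every point of $Q$ there passes an integral manifold of $D$: an (injectively) immersed $r$-dimensional submanifold $N\subset Q$ with $T_xN=D_x$ for all $x\in N$. -/

import Mathlib

open Bundle Set
open scoped Manifold ContDiff

noncomputable section

/-- The model of the fibres of the cotangent bundle, `(ℝⁿ)*`. -/
abbrev CotangentModel (n : ℕ) : Type :=
  EuclideanSpace ℝ (Fin n) →L[ℝ] ℝ

section Cotangent

variable (n : ℕ) (Q : Type*) [TopologicalSpace Q] [ChartedSpace (EuclideanSpace ℝ (Fin n)) Q]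

/-- The cotangent bundle `T*Q`, as the total space of the bundle with fibres `(T_q Q)*`. It is a
smooth manifold modelled on `ℝⁿ × (ℝⁿ)*` through Mathlib's bundles of continuous linear maps. -/
abbrev Cotangent [IsManifold (𝓡 n) ∞ Q] : Type _ :=
  TotalSpace (CotangentModel n) (fun q : Q => TangentSpace (𝓡 n) q →L[ℝ] ℝ)

variable {n Q} [IsManifold (𝓡 n) ∞ Q]

/-- The coordinates of `T*Q` at `α₀`: the chart of the manifold `T*Q` around `α₀`. These are the
canonical cotangent coordinates `(q^a, p_a)` induced by a chart `(q^a)` of `Q` around the base point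
of `α₀`, see `cotangentChart_apply`. -/
def cotangentChart (α₀ : Cotangent n Q) :
    PartialEquiv (Cotangent n Q) (EuclideanSpace ℝ (Fin n) × CotangentModel n) :=
  extChartAt ((𝓡 n).prod 𝓘(ℝ, CotangentModel n)) α₀

/-- Consistency check: with `χ` the preferred chart of `Q` around the base point of `α₀`, the
coordinates of a covector `α` at `q` are `χ(q)` and the covector `p = α ∘ (dχ_q)⁻¹` on `ℝⁿ`, that is
`p ∘ dχ_q = α`. -/
theorem cotangentChart_apply (α₀ α : Cotangent n Q)
    (h : α.proj ∈ (chartAt (EuclideanSpace ℝ (Fin n)) α₀.proj).source) :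
    (cotangentChart α₀ α).1 = extChartAt (𝓡 n) α₀.proj α.proj ∧
      ∀ v : TangentSpace (𝓡 n) α.proj, (cotangentChart α₀ α).2
        (mfderiv (𝓡 n) 𝓘(ℝ, EuclideanSpace ℝ (Fin n)) (extChartAt (𝓡 n) α₀.proj) α.proj v)
          = α.2 v := by
  have hc : chartAt (ModelProd (EuclideanSpace ℝ (Fin n)) (CotangentModel n)) α₀ α = _ :=
    hom_chart α₀ α
  have hx : cotangentChart α₀ α =
      chartAt (ModelProd (EuclideanSpace ℝ (Fin n)) (CotangentModel n)) α₀ α := rfl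
  rw [hx, hc]
  have hb : α.proj ∈ (trivializationAt (EuclideanSpace ℝ (Fin n))
      (TangentSpace (𝓡 n) : Q → Type _) α₀.proj).baseSet := h
  have he : ContinuousLinearMap.inCoordinates (EuclideanSpace ℝ (Fin n))
      (TangentSpace (𝓡 n) : Q → Type _) ℝ (Bundle.Trivial Q ℝ) α₀.proj α.proj α₀.proj α.proj α.2 =
      α.2 ∘L (trivializationAt (EuclideanSpace ℝ (Fin n))
        (TangentSpace (𝓡 n) : Q → Type _) α₀.proj).symmL ℝ α.proj := by
    ext w
    simp [ContinuousLinearMap.inCoordinates]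
  refine ⟨rfl, fun v => ?_⟩
  rw [← TangentBundle.continuousLinearMapAt_trivializationAt h]
  have h2 := (trivializationAt (EuclideanSpace ℝ (Fin n))
      (TangentSpace (𝓡 n) : Q → Type _) α₀.proj).symmL_continuousLinearMapAt (R := ℝ) hb v
  exact (DFunLike.congr_fun he _).trans (congrArg α.2 h2)

/-- The canonical Poisson bracket of `T*Q`: in canonical coordinates,
`{φ, ψ} = ∑ a, (∂φ/∂q^a ∂ψ/∂p_a - ∂φ/∂p_a ∂ψ/∂q^a)`. -/
def canonicalPoissonBracket (φ ψ : Cotangent n Q → ℝ) (α : Cotangent n Q) : ℝ :=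
  let χ := cotangentChart α
  let dφ := fderiv ℝ (φ ∘ χ.symm) (χ α)
  let dψ := fderiv ℝ (ψ ∘ χ.symm) (χ α)
  -- the coordinate directions `∂/∂q^a` and `∂/∂p_a`
  let q : Fin n → EuclideanSpace ℝ (Fin n) × CotangentModel n :=
    fun a => (EuclideanSpace.single a 1, 0)
  let p : Fin n → EuclideanSpace ℝ (Fin n) × CotangentModel n :=
    fun a => (0, EuclideanSpace.proj a)
  ∑ a, (dφ (q a) * dψ (p a) - dφ (p a) * dψ (q a))

end Cotangent

section Distribution

variable {n r : ℕ} {Q : Type*} [TopologicalSpace Q] [ChartedSpace (EuclideanSpace ℝ (Fin n)) Q]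
  [IsManifold (𝓡 n) ∞ Q]
  (g : ContMDiffRiemannianMetric (𝓡 n) ∞ (EuclideanSpace ℝ (Fin n))
    (fun q : Q => TangentSpace (𝓡 n) q))
  (D : ∀ q : Q, Submodule ℝ (TangentSpace (𝓡 n) q))

/-- `D_q^⊥`, the orthogonal complement of `D_q` in `T_q Q` for the metric `g`. -/
def metricOrthogonal (q : Q) : Submodule ℝ (TangentSpace (𝓡 n) q) where
  carrier := {v | ∀ w ∈ D q, g.inner q v w = 0}
  zero_mem' := by intro w _; simp
  add_mem' := by intro a b ha hb w hw; simp [ha w hw, hb w hw]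
  smul_mem' := by intro c a ha w hw; simp [ha w hw]

/-- `T_q Q = D_q ⊕ D_q^⊥`. -/
theorem isCompl_metricOrthogonal (q : Q) : IsCompl (D q) (metricOrthogonal g D q) := by
  have : FiniteDimensional ℝ (TangentSpace (𝓡 n) q) :=
    inferInstanceAs (FiniteDimensional ℝ (EuclideanSpace ℝ (Fin n)))
  let B : LinearMap.BilinForm ℝ (TangentSpace (𝓡 n) q) :=
    LinearMap.mk₂ ℝ (fun v w => g.inner q v w) (by simp) (by simp) (by simp) (by simp)
  have hr : B.IsRefl := fun v w h => by
    change g.inner q w v = 0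
    rw [g.symm]; exact h
  have hB : metricOrthogonal g D q = B.orthogonal (D q) := by
    ext v
    refine forall₂_congr fun w _ => ?_
    change g.inner q v w = 0 ↔ g.inner q w v = 0
    rw [g.symm]
  rw [hB, LinearMap.BilinForm.isCompl_orthogonal_iff_disjoint hr, ← hB, Submodule.disjoint_def]
  intro v hv hv'
  by_contra h
  exact (g.pos q v h).ne' (hv' v hv)

/-- The projection `𝒫 : T_q Q → D_q` of the decomposition `T_q Q = D_q ⊕ D_q^⊥`. -/
def orthProjection (q : Q) : TangentSpace (𝓡 n) q →L[ℝ] D q where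
  toLinearMap := (D q).projectionOnto _ (isCompl_metricOrthogonal g D q)
  cont := by
    have : FiniteDimensional ℝ (TangentSpace (𝓡 n) q) :=
      inferInstanceAs (FiniteDimensional ℝ (EuclideanSpace ℝ (Fin n)))
    have : T2Space (TangentSpace (𝓡 n) q) :=
      inferInstanceAs (T2Space (EuclideanSpace ℝ (Fin n)))
    exact LinearMap.continuous_of_finiteDimensional _

variable (r) in
/-- The dual bundle `D*`, as the total space of the bundle with fibres `(D_q)*`. When `D` is a
smooth vector bundle, this is a smooth manifold modelled on `ℝⁿ × (ℝʳ)*` through Mathlib's bundles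
of continuous linear maps. -/
abbrev DualDistribution : Type _ :=
  TotalSpace (CotangentModel r) (fun q : Q => D q →L[ℝ] ℝ)

/-- `i_D^* : T*Q → D*`, the dual of the inclusion `i_D : D → TQ`: restriction of covectors. -/
def inclusionDual (α : Cotangent n Q) : DualDistribution r D :=
  ⟨α.proj, α.2 ∘L (D α.proj).subtypeL⟩

/-- `𝒫^* : D* → T*Q`, the dual of the orthogonal projection `𝒫 : TQ → D`. -/
def projectionDual (β : DualDistribution r D) : Cotangent n Q :=
  ⟨β.proj, β.2 ∘L orthProjection g D β.proj⟩

/-- The nonholonomic bracket `{φ, ψ}_{D*} = {φ ∘ i_D^*, ψ ∘ i_D^*}_{T*Q} ∘ 𝒫^*` on `D*`. -/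
def nonholonomicBracket (φ ψ : DualDistribution r D → ℝ) : DualDistribution r D → ℝ :=
  canonicalPoissonBracket (φ ∘ inclusionDual D) (ψ ∘ inclusionDual D) ∘ projectionDual g D

/-- A distribution `D` of rank `r` is integrable if through every point `q` of `Q` there passes an
integral manifold of `D`: an injectively immersed `r`-dimensional submanifold, here given by a
parametrization `f` on an open set `W` of `ℝʳ`, whose tangent space at each of its points is the
fibre of `D` there. -/
def IsIntegrableDistribution (r : ℕ) (D : ∀ q : Q, Submodule ℝ (TangentSpace (𝓡 n) q)) : Prop :=
  ∀ q : Q, ∃ (W : Set (EuclideanSpace ℝ (Fin r))) (f : EuclideanSpace ℝ (Fin r) → Q),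
    IsOpen W ∧ q ∈ f '' W ∧ ContMDiffOn (𝓡 r) (𝓡 n) ∞ f W ∧ InjOn f W ∧
    ∀ x ∈ W, Function.Injective (mfderiv (𝓡 r) (𝓡 n) f x) ∧
      LinearMap.range (mfderiv (𝓡 r) (𝓡 n) f x).toLinearMap = D (f x)

end Distribution

end

/-! Everything is local. Near `q₀`, in the preferred chart, choose a frame `B x : ℝʳ → ℝⁿ` of `D`
that admits a constant left inverse `pr`, so that `pr (B x v) = v` (`AdaptedFrame`). Write `T(u, v)
= [B u, B v]` for the Lie brackets of the frame fields (`frameTorsion`). Differentiating `pr (B x v)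
= v` gives `pr ∘ T = 0`. Since `ker pr` is a complement of the range of `B`, the brackets `T` lie in
`D` only if they vanish: for such a frame, involutivity means that the frame fields commute.

In the coordinates `(x, p)` of `D*` given by the frame, `i_D^*` is `(x, p) ↦ (x, p ∘ B x)` and `𝒫^*`
is `(x, p) ↦ (x, p ∘ C x)`, where `C` expresses the orthogonal projection. The nonholonomic bracket
becomes `F_x(B G_p) - G_x(B F_p) + p(C T(G_p, F_p))` (`frameBracket`,
`AdaptedFrame.nonholonomicBracket_dualMk`). The metric enters only through `C`.

Integrable implies Jacobi: an integral manifold through each point forces `T = 0`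
(`frameTorsion_eq_zero_of_integral`). The bracket is then the bivector `∑ B eᵢ ∧ ∂/∂pᵢ` of pairwise
commuting fields, hence Poisson (`bivectorBracket_jacobi`).

Jacobi implies integrable: the identity for `p(u)`, `p(v)` and `l(x)` at `p = 0` reads `l(T) = l(B C
T)`, so `T` lies in `D` and therefore vanishes (`frameTorsion_eq_zero_of_jacobi`). Vanishing torsion
is the integrability condition of the total differential equation `f' = B ∘ f`; its solution through
`q₀` parametrizes an integral manifold (`exists_contDiffOn_hasFDerivAt_of_symmetric`). Cutoff
functions supply global test functions on `D*`. -/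

/-! ### Frobenius theorem in the form of a total differential equation. -/

section Frobenius

open Metric Filter Asymptotics
open scoped Topology NNReal

/-- The confinement of the solution to the ball of radius `a` is what makes the bounds on the vector
field usable along it. -/
theorem IsPicardLindelof.exists_mem_closedBall_hasDerivWithinAt {E : Type*} [NormedAddCommGroup E]
    [NormedSpace ℝ E] [CompleteSpace E] {f : ℝ → E → E} {tmin tmax : ℝ} {t₀ : Icc tmin tmax}
    {x₀ x : E} {a r L K : ℝ≥0} (hf : IsPicardLindelof f t₀ x₀ a r L K) (hx : x ∈ closedBall x₀ r) :
    ∃ α : ℝ → E, α t₀ = x ∧ (∀ t, α t ∈ closedBall x₀ a) ∧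
      ∀ t ∈ Icc tmin tmax, HasDerivWithinAt α (f t (α t)) (Icc tmin tmax) t := by
  obtain ⟨α, hα⟩ := ODE.FunSpace.exists_isFixedPt_next hf hx
  refine ⟨α.compProj, by rw [ODE.FunSpace.compProj_val, ← hα, ODE.FunSpace.next_apply₀],
    fun t => α.compProj_mem_closedBall hf.mul_max_le, fun t ht ↦ ?_⟩
  apply ODE.hasDerivWithinAt_picard_Icc t₀.2 hf.continuousOn_uncurry
    α.continuous_compProj.continuousOn (fun _ ht' ↦ α.compProj_mem_closedBall hf.mul_max_le)
    x ht |>.congr_of_mem _ ht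
  intro t' ht'
  nth_rw 1 [← hα]
  rw [ODE.FunSpace.compProj_of_mem ht', ODE.FunSpace.next_apply]

/-- With equal initial values the Grönwall bound is linear in the defect, so a defect quadratic in
`w` yields an error quadratic in `w`. -/
theorem gronwallBound_zero_eq_mul (K ε x : ℝ) :
    gronwallBound 0 K ε x = ε * gronwallBound 0 K 1 x := by
  unfold gronwallBound
  split_ifs <;> ring

theorem ContinuousAt.eventually_norm_lt {X F : Type*} [TopologicalSpace X] [NormedAddCommGroup F]
    {f : X → F} {x : X} (h : ContinuousAt f x) : ∀ᶠ y in 𝓝 x, ‖f y‖ < ‖f x‖ + 1 :=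
  h.norm.eventually_lt_const (lt_add_one _)

variable {E V : Type*} [NormedAddCommGroup E] [NormedSpace ℝ E] [NormedAddCommGroup V]
  [NormedSpace ℝ V]

/-- Mean value inequality on the segment, where `B'` differs from `B' x` by at most `M * ‖y - x‖`.
The sharper constant `M / 2` is not needed. -/
theorem norm_map_add_sub_sub_le_of_lipschitz_deriv {F : Type*} [NormedAddCommGroup F]
    [NormedSpace ℝ F] {B : E → F} {B' : E → E →L[ℝ] F} {s : Set E} (hs : Convex ℝ s) {M : ℝ}
    (hM : 0 ≤ M)
    (hB : ∀ x ∈ s, HasFDerivAt B (B' x) x)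
    (hlip : ∀ x ∈ s, ∀ y ∈ s, ‖B' x - B' y‖ ≤ M * ‖x - y‖) {x y : E} (hx : x ∈ s) (hy : y ∈ s) :
    ‖B y - B x - B' x (y - x)‖ ≤ M * ‖y - x‖ * ‖y - x‖ := by
  refine ((convex_segment x y)).norm_image_sub_le_of_norm_hasFDerivWithin_le'
    (s := segment ℝ x y) (f' := B') (fun z hz => ?_) (fun z hz => ?_)
    (left_mem_segment ℝ x y) (right_mem_segment ℝ x y)
  · exact (hB z (hs.segment_subset hx hy hz)).hasFDerivWithinAt
  · refine (hlip z (hs.segment_subset hx hy hz) x hx).trans ?_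
    gcongr
    have := norm_sub_le_of_mem_segment hz
    rwa [norm_sub_rev z x, norm_sub_rev y x] at *

/-- Integrate along rays: let `y v` solve `y' = B(y) v`, `y(0) = x₀`, and put `f v = y v 1`. The
expected variation of `y v` in the direction `w` is `t • B(y v t) w`. Under the symmetry condition,
`y v + t • B(y v) w` solves the equation for `v + w` up to an error `O(‖w‖²)`, and Grönwall's
inequality then shows that `B (f v)` is the derivative of `f`. -/
theorem exists_hasFDerivAt_of_symmetric_aux [CompleteSpace E] {B : E → V →L[ℝ] E}
    {B' : E → E →L[ℝ] V →L[ℝ] E} {x₀ : E}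
    {R M : ℝ≥0} (hR : 0 < R) (hB : ∀ x ∈ closedBall x₀ R, HasFDerivAt B (B' x) x)
    (hBM : ∀ x ∈ closedBall x₀ R, ‖B x‖ ≤ M) (hBM' : ∀ x ∈ closedBall x₀ R, ‖B' x‖ ≤ M)
    (hlip : ∀ x ∈ closedBall x₀ R, ∀ y ∈ closedBall x₀ R, ‖B' x - B' y‖ ≤ M * ‖x - y‖)
    (hsymm : ∀ x ∈ closedBall x₀ R, ∀ v w, B' x (B x v) w = B' x (B x w) v) :
    ∃ ε > 0, ∃ f : V → E, f 0 = x₀ ∧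
      ∀ v ∈ ball (0 : V) ε, f v ∈ closedBall x₀ R ∧ HasFDerivAt f (B (f v)) v := by
  -- Chosen so that `M * ε ≤ R / 2`: solutions move at most `R / 2` in unit time, and the correction
  -- `t • B(y) w` adds at most another `R / 2`.
  set ε : ℝ≥0 := R / 2 / (M + 1) with hε
  have hε0 : 0 < ε := by positivity
  have hMε : M * ε ≤ R / 2 := by
    rw [hε]
    calc M * (R / 2 / (M + 1)) = R / 2 * (M / (M + 1)) := by ring
      _ ≤ R / 2 * 1 := by
        gcongr
        exact div_le_one_of_le₀ (by simp) (by positivity)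
      _ = _ := mul_one _
  have hsub : closedBall x₀ (R / 2 : ℝ≥0) ⊆ closedBall x₀ R :=
    closedBall_subset_closedBall (by push_cast; linarith [R.2])
  have hLB : LipschitzOnWith M B (closedBall x₀ R) := by
    refine (convex_closedBall x₀ R).lipschitzOnWith_of_nnnorm_hasFDerivWithin_le
      (fun x hx => (hB x hx).hasFDerivWithinAt) fun x hx => ?_
    exact_mod_cast hBM' x hx
  have hLv : ∀ v : V, ‖v‖ ≤ ε → LipschitzOnWith (M * ε) (fun x => B x v) (closedBall x₀ R) := by
    intro v hv
    refine LipschitzOnWith.of_dist_le_mul fun x hx y hy => ?_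
    have h1 := hLB.dist_le_mul x hx y hy
    rw [dist_eq_norm] at h1 ⊢
    rw [← sub_apply]
    calc ‖(B x - B y) v‖ ≤ ‖B x - B y‖ * ‖v‖ := ContinuousLinearMap.le_opNorm _ _
      _ ≤ (M * dist x y) * ε := by gcongr
      _ = _ := by push_cast; ring
  have hex : ∀ v : V, ∃ y : ℝ → E, ‖v‖ ≤ ε → y 0 = x₀ ∧ (∀ t, y t ∈ closedBall x₀ (R / 2 : ℝ≥0)) ∧
      ∀ t ∈ Icc (0 : ℝ) 1, HasDerivWithinAt y (B (y t) v) (Icc 0 1) t := by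
    intro v
    by_cases hv : ‖v‖ ≤ ε
    · have hPL : IsPicardLindelof (fun _ x => B x v) (⟨0, by simp⟩ : Icc (0 : ℝ) 1) x₀ (R / 2) 0
          (M * ε) (M * ε) :=
        { lipschitzOnWith := fun t _ => (hLv v hv).mono hsub
          continuousOn := fun x _ => continuousOn_const
          norm_le := fun t _ x hx => by
            refine (ContinuousLinearMap.le_opNorm _ _).trans ?_
            push_cast
            gcongr
            exact hBM x (hsub hx)
          mul_max_le := by
            have : ((M * ε : ℝ≥0) : ℝ) ≤ (R / 2 : ℝ≥0) := by exact_mod_cast hMε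
            simpa using this }
      obtain ⟨y, h1, h2, h3⟩ := hPL.exists_mem_closedBall_hasDerivWithinAt
        (x := x₀) (mem_closedBall_self (by simp))
      exact ⟨y, fun _ => ⟨h1, h2, h3⟩⟩
    · exact ⟨fun _ => x₀, fun h => absurd h hv⟩
  choose y hy using hex
  refine ⟨ε, by exact_mod_cast hε0, fun v => y v 1, ?_, fun v hv => ?_⟩
  · obtain ⟨h1, h2, h3⟩ := hy 0 (by simp)
    rw [← h1]
    have : ∀ t ∈ Icc (0 : ℝ) 1, HasDerivWithinAt (y 0) 0 (Icc 0 1) t := by simpa using h3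
    have h4 := (convex_Icc (0 : ℝ) 1).norm_image_sub_le_of_norm_hasDerivWithin_le (C := 0)
      this (by simp) (left_mem_Icc.2 zero_le_one) (right_mem_Icc.2 zero_le_one)
    simpa [sub_eq_zero] using h4
  rw [mem_ball_zero_iff] at hv
  obtain ⟨h1, h2, h3⟩ := hy v hv.le
  refine ⟨hsub (h2 1), ?_⟩
  set C : ℝ := M * M + M * M * M * ε with hC
  set G : ℝ := gronwallBound 0 (M * ε : ℝ≥0) 1 1 with hG
  have key : ∀ w : V, ‖v + w‖ ≤ ε → ‖w‖ ≤ ε →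
      ‖y (v + w) 1 - y v 1 - B (y v 1) w‖ ≤ G * C * ‖w‖ ^ 2 := by
    intro w hvw hw
    obtain ⟨h1', h2', h3'⟩ := hy (v + w) hvw
    have hh : ∀ t ∈ Icc (0 : ℝ) 1, ‖t • B (y v t) w‖ ≤ M * ‖w‖ := by
      intro t ht
      rw [norm_smul, Real.norm_of_nonneg ht.1]
      calc t * ‖B (y v t) w‖ ≤ 1 * (M * ‖w‖) := by
            gcongr
            · exact ht.2
            · exact (ContinuousLinearMap.le_opNorm _ _).trans (by
                gcongr; exact hBM _ (hsub (h2 t)))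
        _ = _ := one_mul _
    have hz : ∀ t ∈ Icc (0 : ℝ) 1, y v t + t • B (y v t) w ∈ closedBall x₀ R := by
      intro t ht
      have h5 := h2 t
      rw [mem_closedBall, dist_eq_norm] at h5 ⊢
      have h6 := hh t ht
      have h7 : (M : ℝ) * ‖w‖ ≤ R / 2 := by
        calc (M : ℝ) * ‖w‖ ≤ M * ε := by gcongr
          _ ≤ _ := by exact_mod_cast hMε
      calc ‖y v t + t • B (y v t) w - x₀‖ = ‖(y v t - x₀) + t • B (y v t) w‖ := by congr 1; abel
        _ ≤ _ := norm_add_le _ _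
        _ ≤ (R / 2 : ℝ≥0) + R / 2 := by gcongr; exact h6.trans h7
        _ = R := by push_cast; ring
    have hder : ∀ t ∈ Icc (0 : ℝ) 1, HasDerivWithinAt (fun t => y v t + t • B (y v t) w)
        (B (y v t) v + (t • B' (y v t) (B (y v t) v) w + (1 : ℝ) • B (y v t) w)) (Icc 0 1) t := by
      intro t ht
      have hBy : HasDerivWithinAt (fun t => B (y v t)) (B' (y v t) (B (y v t) v)) (Icc 0 1) t :=
        (hB _ (hsub (h2 t))).comp_hasDerivWithinAt t (h3 t ht)
      have hBw : HasDerivWithinAt (fun t => B (y v t) w) (B' (y v t) (B (y v t) v) w)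
          (Icc 0 1) t := by
        simpa using hBy.clm_apply (hasDerivWithinAt_const t _ w)
      exact (h3 t ht).fun_add ((hasDerivWithinAt_id t _).smul hBw)
    have hIci : ∀ {g : ℝ → E} {g' : E} {t : ℝ}, t ∈ Ico (0 : ℝ) 1 →
        HasDerivWithinAt g g' (Icc 0 1) t → HasDerivWithinAt g g' (Ici t) t := fun ht hg =>
      hg.mono_of_mem_nhdsWithin (mem_of_superset (Icc_mem_nhdsGE ht.2) (Icc_subset_Icc_left ht.1))
    -- Compare the exact solution for `v + w` (defect `0`) with the approximate one (defect `C * ‖w‖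
    -- ^ 2`).
    have hgr := dist_le_of_approx_trajectories_ODE_of_mem (E := E) (a := 0) (b := 1)
      (v := fun _ x => B x (v + w)) (s := fun _ => closedBall x₀ R) (K := M * ε)
      (f := y (v + w)) (f' := fun t => B (y (v + w) t) (v + w)) (εf := 0)
      (g := fun t => y v t + t • B (y v t) w) (εg := C * ‖w‖ ^ 2) (δ := 0)
      (g' := fun t => B (y v t) v + (t • B' (y v t) (B (y v t) v) w + (1 : ℝ) • B (y v t) w))
      (fun t _ => hLv _ hvw)
      (fun t ht => (h3' t ht).continuousWithinAt)
      (fun t ht => hIci ht (h3' t (Ico_subset_Icc_self ht)))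
      (fun t _ => by simp) (fun t _ => hsub (h2' t))
      (fun t ht => (hder t ht).continuousWithinAt)
      (fun t ht => hIci ht (hder t (Ico_subset_Icc_self ht)))
      (fun t ht => ?_) (fun t ht => hz t (Ico_subset_Icc_self ht))
      (by simp [h1, h1']) 1 (right_mem_Icc.2 zero_le_one)
    · rw [zero_add, sub_zero, gronwallBound_zero_eq_mul, dist_eq_norm] at hgr
      simp only [one_smul] at hgr
      rw [← sub_sub] at hgr
      refine hgr.trans (le_of_eq ?_)
      rw [hG]; ring
    · have ht' := Ico_subset_Icc_self ht
      set p := y v t with hp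
      have hpR : p ∈ closedBall x₀ R := hsub (h2 t)
      set h := t • B p w with hhdef
      have htay := norm_map_add_sub_sub_le_of_lipschitz_deriv (convex_closedBall x₀ R) M.2 hB
        hlip hpR (hz t ht')
      rw [← hp, ← hhdef, add_sub_cancel_left] at htay
      rw [dist_eq_norm]
      -- The first-order terms cancel here: symmetry turns `B'(B w) v`, from the Taylor expansion of
      -- `B (p + h)`, into `B'(B v) w`, from the derivative of the approximate solution. What
      -- remains is quadratic in `w`.
      have hid : B p v + (t • B' p (B p v) w + (1 : ℝ) • B p w) - B (p + h) (v + w) =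
          -(t • B' p (B p w) w) - (B (p + h) - B p - B' p h) (v + w) := by
        have e1 : B' p h (v + w) = t • B' p (B p v) w + t • B' p (B p w) w := by
          rw [hhdef, map_smul, smul_apply, map_add, hsymm p hpR w v, smul_add]
        rw [sub_apply, sub_apply, e1, one_smul]
        simp only [map_add]
        abel
      rw [hid]
      have hhn : ‖h‖ ≤ M * ‖w‖ := hh t ht'
      have n1 : ‖t • B' p (B p w) w‖ ≤ M * M * ‖w‖ ^ 2 := by
        rw [norm_smul, Real.norm_of_nonneg ht'.1]
        have a1 : ‖B p w‖ ≤ M * ‖w‖ :=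
          (ContinuousLinearMap.le_opNorm _ _).trans (by gcongr; exact hBM p hpR)
        have a2 : ‖B' p (B p w)‖ ≤ M * (M * ‖w‖) :=
          (ContinuousLinearMap.le_opNorm _ _).trans (by gcongr; exact hBM' p hpR)
        calc t * ‖B' p (B p w) w‖ ≤ 1 * (M * (M * ‖w‖) * ‖w‖) := by
              gcongr
              · exact ht'.2
              · exact (ContinuousLinearMap.le_opNorm _ _).trans (by gcongr)
          _ = _ := by ring
      have n2 : ‖(B (p + h) - B p - B' p h) (v + w)‖ ≤ M * M * M * ε * ‖w‖ ^ 2 := by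
        calc _ ≤ ‖B (p + h) - B p - B' p h‖ * ‖v + w‖ := ContinuousLinearMap.le_opNorm _ _
          _ ≤ (M * (M * ‖w‖) * (M * ‖w‖)) * ε := by
              gcongr
              refine htay.trans ?_
              gcongr
              exact le_rfl
          _ = _ := by ring
      calc _ ≤ ‖-(t • B' p (B p w) w)‖ + ‖(B (p + h) - B p - B' p h) (v + w)‖ := norm_sub_le _ _
        _ ≤ M * M * ‖w‖ ^ 2 + M * M * M * ε * ‖w‖ ^ 2 := by rw [norm_neg]; gcongr
        _ = C * ‖w‖ ^ 2 := by rw [hC]; ring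
  rw [hasFDerivAt_iff_isLittleO_nhds_zero]
  have hO : (fun w : V => y (v + w) 1 - y v 1 - B (y v 1) w) =O[𝓝 0] fun w => ‖w‖ ^ 2 := by
    refine IsBigO.of_bound (G * C) ?_
    have e1 : ∀ᶠ w : V in 𝓝 0, ‖w‖ < ε :=
      (continuous_norm.tendsto' (0 : V) 0 norm_zero).eventually_lt_const (by exact_mod_cast hε0)
    have e2 : ∀ᶠ w : V in 𝓝 0, ‖v + w‖ < ε :=
      ((continuous_const.add continuous_id).norm.tendsto' (0 : V) ‖v‖ (by simp)).eventually_lt_const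
        hv
    filter_upwards [e1, e2] with w hw1 hw2
    have := key w hw2.le hw1.le
    rwa [norm_pow, norm_norm]
  exact hO.trans_isLittleO (isLittleO_norm_pow_id one_lt_two)

set_option synthInstance.maxHeartbeats 200000 in
/-- Local solvability of the total differential equation `f' = B ∘ f` for a smooth family of linear
maps `B` satisfying the integrability condition. -/
theorem exists_contDiffOn_hasFDerivAt_of_symmetric [CompleteSpace E] {B : E → V →L[ℝ] E}
    {U : Set E} (hU : IsOpen U) (hB : ContDiffOn ℝ ∞ B U)
    (hsymm : ∀ x ∈ U, ∀ v w, fderiv ℝ B x (B x v) w = fderiv ℝ B x (B x w) v)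
    {x₀ : E} (hx₀ : x₀ ∈ U) :
    ∃ ε > 0, ∃ f : V → E, f 0 = x₀ ∧ ContDiffOn ℝ ∞ f (ball 0 ε) ∧
      ∀ v ∈ ball (0 : V) ε, f v ∈ U ∧ HasFDerivAt f (B (f v)) v := by
  have hBx : ContDiffAt ℝ ∞ B x₀ := hB.contDiffAt (hU.mem_nhds hx₀)
  have hB'x : ContDiffAt ℝ ∞ (fderiv ℝ B) x₀ :=
    ((contDiffOn_infty_iff_fderiv_of_isOpen hU).1 hB).2.contDiffAt (hU.mem_nhds hx₀)
  obtain ⟨K, t, ht, hK⟩ := (hB'x.of_le (m := 1) (by norm_cast)).exists_lipschitzOnWith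
  have e1 : ∀ᶠ x in 𝓝 x₀, ‖B x‖ < ‖B x₀‖ + 1 :=
    hBx.continuousAt.eventually_norm_lt
  have e2 : ∀ᶠ x in 𝓝 x₀, ‖fderiv ℝ B x‖ < ‖fderiv ℝ B x₀‖ + 1 :=
    hB'x.continuousAt.eventually_norm_lt
  obtain ⟨R, hR, hball⟩ := Metric.nhds_basis_closedBall.mem_iff.1
    (((e1.and e2).and (hU.eventually_mem hx₀)).and ht)
  lift R to ℝ≥0 using hR.le
  -- One constant dominating the Lipschitz constant of `B'` and the local bounds of `B` and `B'`.
  set M : ℝ≥0 := K + (‖B x₀‖₊ + 1) + (‖fderiv ℝ B x₀‖₊ + 1) with hM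
  obtain ⟨ε, hε, f, hf0, hf⟩ := exists_hasFDerivAt_of_symmetric_aux (B := B) (B' := fderiv ℝ B)
    (x₀ := x₀) (R := R) (M := M) (by exact_mod_cast hR)
    (fun x hx => ((hB.contDiffAt (hU.mem_nhds (hball hx).1.2)).differentiableAt
      (by simp)).hasFDerivAt)
    (fun x hx => (hball hx).1.1.1.le.trans (by
      rw [hM]; push_cast; linarith [K.2, norm_nonneg (fderiv ℝ B x₀)]))
    (fun x hx => (hball hx).1.1.2.le.trans (by
      rw [hM]; push_cast; linarith [K.2, norm_nonneg (B x₀)]))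
    (fun x hx y hy => by
      have := hK.dist_le_mul x (hball hx).2 y (hball hy).2
      rw [dist_eq_norm, dist_eq_norm] at this
      refine this.trans ?_
      gcongr
      rw [hM, add_assoc]
      exact le_self_add)
    (fun x hx => hsymm x (hball hx).1.2)
  have hfU : ∀ v ∈ ball (0 : V) ε, f v ∈ U := fun v hv => (hball (hf v hv).1).1.2
  refine ⟨ε, hε, f, hf0, ?_, fun v hv => ⟨hfU v hv, (hf v hv).2⟩⟩
  -- Bootstrap: if `f` is `C^k`, then so is `f' = B ∘ f`, hence `f` is `C^(k+1)`.
  rw [contDiffOn_infty]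
  intro k
  induction k with
  | zero =>
    exact contDiffOn_zero.2 fun v hv => (hf v hv).2.continuousAt.continuousWithinAt
  | succ k ih =>
    push_cast
    rw [contDiffOn_succ_iff_fderiv_of_isOpen isOpen_ball]
    refine ⟨fun v hv => (hf v hv).2.differentiableAt.differentiableWithinAt, by simp, ?_⟩
    refine ContDiffOn.congr (f := B ∘ f) ?_ fun v hv => (hf v hv).2.fderiv
    exact (hB.of_le (by exact_mod_cast le_top)).comp ih hfU

end Frobenius

/-! ### The canonical bracket in coordinates and its behaviour under pullback. -/

section CoordinateBracket

open Filter
open scoped Topology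

variable {n r : ℕ} {X : Type*} [NormedAddCommGroup X] [NormedSpace ℝ X]

/-- The component of a linear functional `L` on `X × (ℝʳ)*` along the second factor, as a vector of
`ℝʳ`. -/
noncomputable def fiberVec :
    (X × CotangentModel r →L[ℝ] ℝ) →L[ℝ] EuclideanSpace ℝ (Fin r) :=
  ∑ a, (ContinuousLinearMap.apply ℝ ℝ
    ((0, EuclideanSpace.proj a) : X × CotangentModel r)).smulRight (EuclideanSpace.single a 1)

theorem apply_eq_sum_proj (p : CotangentModel r) (v : EuclideanSpace ℝ (Fin r)) :
    p v = ∑ a, v a * p (EuclideanSpace.single a 1) := by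
  conv_lhs => rw [← (EuclideanSpace.basisFun (Fin r) ℝ).sum_repr v]
  simp

theorem cotangentModel_eq_sum (p : CotangentModel r) :
    p = ∑ a, p (EuclideanSpace.single a 1) • (EuclideanSpace.proj a : CotangentModel r) := by
  ext v
  rw [apply_eq_sum_proj p v]
  simp [mul_comm]

theorem fiberVec_apply (L : X × CotangentModel r →L[ℝ] ℝ) (a : Fin r) :
    fiberVec L a = L (0, EuclideanSpace.proj a) := by
  simp [fiberVec, Pi.single_apply]

theorem apply_zero_prod (L : X × CotangentModel r →L[ℝ] ℝ) (p : CotangentModel r) :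
    L (0, p) = p (fiberVec L) := by
  have h : ((0 : X), p) = ∑ a, p (EuclideanSpace.single a 1) •
      ((0 : X), (EuclideanSpace.proj a : CotangentModel r)) := by
    ext1
    · simp [Prod.fst_sum]
    · simpa [Prod.snd_sum] using cotangentModel_eq_sum p
  rw [h, map_sum, apply_eq_sum_proj]
  exact Finset.sum_congr rfl fun a _ => by rw [map_smul, fiberVec_apply, smul_eq_mul, mul_comm]

theorem apply_prod (L : X × CotangentModel r →L[ℝ] ℝ) (x : X) (p : CotangentModel r) :
    L (x, p) = L (x, 0) + p (fiberVec L) := by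
  rw [← apply_zero_prod, ← map_add]; simp

theorem fiberVec_eq_of_forall {L : X × CotangentModel r →L[ℝ] ℝ} {v : EuclideanSpace ℝ (Fin r)}
    (h : ∀ p : CotangentModel r, L (0, p) = p v) : fiberVec L = v := by
  ext a
  simpa [fiberVec_apply] using h (EuclideanSpace.proj a)

/-- The canonical Poisson tensor of `ℝⁿ × (ℝⁿ)*`. -/
noncomputable def coordBracket
    (L M : EuclideanSpace ℝ (Fin n) × CotangentModel n →L[ℝ] ℝ) : ℝ :=
  L (fiberVec M, 0) - M (fiberVec L, 0)

theorem coordBracket_eq_sum (L M : EuclideanSpace ℝ (Fin n) × CotangentModel n →L[ℝ] ℝ) :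
    coordBracket L M = ∑ a, (L (EuclideanSpace.single a 1, 0) * M (0, EuclideanSpace.proj a)
      - L (0, EuclideanSpace.proj a) * M (EuclideanSpace.single a 1, 0)) := by
  have h : ∀ (L : EuclideanSpace ℝ (Fin n) × CotangentModel n →L[ℝ] ℝ)
      (v : EuclideanSpace ℝ (Fin n)), L (v, 0) = ∑ a, v a * L (EuclideanSpace.single a 1, 0) :=
    fun L v => apply_eq_sum_proj (L ∘L ContinuousLinearMap.inl ℝ _ _) v
  rw [coordBracket, h L, h M, Finset.sum_sub_distrib]
  simp only [fiberVec_apply, mul_comm]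

/-- The bracket of two functions pulled back along a map `(x, p) ↦ (τ x, p ∘ B x)`. -/
theorem coordBracket_fderiv_pullback {τ : EuclideanSpace ℝ (Fin n) → X}
    {τ' : EuclideanSpace ℝ (Fin n) →L[ℝ] X}
    {B : EuclideanSpace ℝ (Fin n) → EuclideanSpace ℝ (Fin r) →L[ℝ] EuclideanSpace ℝ (Fin n)}
    {B' : EuclideanSpace ℝ (Fin n) →L[ℝ]
      EuclideanSpace ℝ (Fin r) →L[ℝ] EuclideanSpace ℝ (Fin n)}
    {x : EuclideanSpace ℝ (Fin n)} {p : CotangentModel n}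
    (hτ : HasFDerivAt τ τ' x) (hB : HasFDerivAt B B' x)
    {F G : X × CotangentModel r → ℝ} {Φ Γ : EuclideanSpace ℝ (Fin n) × CotangentModel n → ℝ}
    (hF : DifferentiableAt ℝ F (τ x, p ∘L B x)) (hG : DifferentiableAt ℝ G (τ x, p ∘L B x))
    (hΦ : Φ =ᶠ[𝓝 (x, p)] fun z => F (τ z.1, z.2 ∘L B z.1))
    (hΓ : Γ =ᶠ[𝓝 (x, p)] fun z => G (τ z.1, z.2 ∘L B z.1)) :
    DifferentiableAt ℝ Φ (x, p) ∧ DifferentiableAt ℝ Γ (x, p) ∧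
    coordBracket (fderiv ℝ Φ (x, p)) (fderiv ℝ Γ (x, p)) =
      fderiv ℝ F (τ x, p ∘L B x) (τ' (B x (fiberVec (fderiv ℝ G (τ x, p ∘L B x)))), 0)
      - fderiv ℝ G (τ x, p ∘L B x) (τ' (B x (fiberVec (fderiv ℝ F (τ x, p ∘L B x)))), 0)
      + p (B' (B x (fiberVec (fderiv ℝ G (τ x, p ∘L B x))))
            (fiberVec (fderiv ℝ F (τ x, p ∘L B x)))
          - B' (B x (fiberVec (fderiv ℝ F (τ x, p ∘L B x))))
            (fiberVec (fderiv ℝ G (τ x, p ∘L B x)))) := by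
  set K : EuclideanSpace ℝ (Fin n) × CotangentModel n → X × CotangentModel r :=
    fun z => (τ z.1, z.2 ∘L B z.1) with hK
  obtain ⟨K', hK', hK'v⟩ : ∃ K' : EuclideanSpace ℝ (Fin n) × CotangentModel n →L[ℝ]
      X × CotangentModel r, HasFDerivAt K K' (x, p) ∧
      ∀ y q, K' (y, q) = (τ' y, p ∘L B' y + q ∘L B x) := by
    have h1 : HasFDerivAt (fun z : EuclideanSpace ℝ (Fin n) × CotangentModel n => τ z.1)
        (τ' ∘L ContinuousLinearMap.fst ℝ _ _) (x, p) := HasFDerivAt.comp (x, p) hτ hasFDerivAt_fst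
    have h2 : HasFDerivAt (fun z : EuclideanSpace ℝ (Fin n) × CotangentModel n => B z.1)
        (B' ∘L ContinuousLinearMap.fst ℝ _ _) (x, p) := HasFDerivAt.comp (x, p) hB hasFDerivAt_fst
    have h3 := (hasFDerivAt_snd (𝕜 := ℝ) (p := (x, p))).clm_comp h2
    exact ⟨_, h1.prodMk h3, fun y q => by simp⟩
  -- Chain rule along `K`: the momentum gradient is pushed forward by `B x`, and the base derivative
  -- gains a term from the variation of `B`.
  have key : ∀ {F : X × CotangentModel r → ℝ} {Φ : EuclideanSpace ℝ (Fin n) × CotangentModel n → ℝ},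
      DifferentiableAt ℝ F (K (x, p)) → Φ =ᶠ[𝓝 (x, p)] F ∘ K → DifferentiableAt ℝ Φ (x, p) ∧
      fiberVec (fderiv ℝ Φ (x, p)) = B x (fiberVec (fderiv ℝ F (K (x, p)))) ∧
      ∀ y, fderiv ℝ Φ (x, p) (y, 0) = fderiv ℝ F (K (x, p)) (τ' y, 0) +
        p (B' y (fiberVec (fderiv ℝ F (K (x, p))))) := by
    intro F Φ hF hΦ
    have hd := (hF.hasFDerivAt.comp (x, p) hK').congr_of_eventuallyEq hΦ
    refine ⟨hd.differentiableAt, ?_, fun y => ?_⟩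
    · refine fiberVec_eq_of_forall fun q => ?_
      rw [hd.fderiv, ContinuousLinearMap.comp_apply, hK'v, apply_prod]
      simp [← Prod.zero_eq_mk]
    · rw [hd.fderiv, ContinuousLinearMap.comp_apply, hK'v, apply_prod]
      simp
  obtain ⟨a1, a2, a3⟩ := key hF hΦ
  obtain ⟨b1, b2, b3⟩ := key hG hΓ
  refine ⟨a1, b1, ?_⟩
  rw [coordBracket, a2, b2, a3, b3, map_sub]
  ring

/-- Invariance of the canonical bracket under the cotangent lift of a change of coordinates. -/
theorem coordBracket_fderiv_coordChange {τ σ : EuclideanSpace ℝ (Fin n) → EuclideanSpace ℝ (Fin n)}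
    {x : EuclideanSpace ℝ (Fin n)} {p p' : CotangentModel n}
    (hτ : DifferentiableAt ℝ τ x) (hσ : ContDiffAt ℝ ∞ σ (τ x))
    (hστ : σ ∘ τ =ᶠ[𝓝 x] id)
    {F G : EuclideanSpace ℝ (Fin n) × CotangentModel n → ℝ}
    {Φ Γ : EuclideanSpace ℝ (Fin n) × CotangentModel n → ℝ}
    (hp' : p' = p ∘L fderiv ℝ σ (τ x))
    (hF : DifferentiableAt ℝ F (τ x, p')) (hG : DifferentiableAt ℝ G (τ x, p'))
    (hΦ : Φ =ᶠ[𝓝 (x, p)] fun z => F (τ z.1, z.2 ∘L fderiv ℝ σ (τ z.1)))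
    (hΓ : Γ =ᶠ[𝓝 (x, p)] fun z => G (τ z.1, z.2 ∘L fderiv ℝ σ (τ z.1))) :
    coordBracket (fderiv ℝ Φ (x, p)) (fderiv ℝ Γ (x, p)) =
      coordBracket (fderiv ℝ F (τ x, p')) (fderiv ℝ G (τ x, p')) := by
  subst hp'
  have hσd : HasFDerivAt σ (fderiv ℝ σ (τ x)) (τ x) :=
    (hσ.differentiableAt (by simp)).hasFDerivAt
  have hleft : fderiv ℝ σ (τ x) ∘L fderiv ℝ τ x = ContinuousLinearMap.id ℝ _ :=
    (hσd.comp x hτ.hasFDerivAt).unique ((hasFDerivAt_id x).congr_of_eventuallyEq hστ)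
  -- In finite dimension a one-sided inverse is two-sided.
  have hright : ∀ v, fderiv ℝ τ x (fderiv ℝ σ (τ x) v) = v := by
    have h1 : (fderiv ℝ σ (τ x)).toLinearMap ∘ₗ (fderiv ℝ τ x).toLinearMap = LinearMap.id := by
      ext v : 1; exact DFunLike.congr_fun hleft v
    exact fun v => DFunLike.congr_fun ((LinearMap.comp_eq_id_comm ℝ _).1 h1) v
  have hσ2 : HasFDerivAt (fderiv ℝ σ) (fderiv ℝ (fderiv ℝ σ) (τ x)) (τ x) :=
    ((hσ.fderiv_right (m := 1) (by norm_cast)).differentiableAt (by simp)).hasFDerivAt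
  have hsymm : IsSymmSndFDerivAt ℝ σ (τ x) := hσ.isSymmSndFDerivAt (by simp; norm_cast)
  have h := (coordBracket_fderiv_pullback hτ.hasFDerivAt (hσ2.comp x hτ.hasFDerivAt) hF hG hΦ
    hΓ).2.2
  rw [h]
  simp only [ContinuousLinearMap.comp_apply, hright, coordBracket, Function.comp_apply]
  -- For `B = σ' ∘ τ` the extra term of the pullback formula antisymmetrizes the second derivative
  -- of `σ`, and so vanishes.
  rw [hsymm.eq, sub_self, map_zero, add_zero]

end CoordinateBracket

/-! ### Commuting frames give a Poisson bracket. -/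

section LocalJacobi

open Filter
open scoped Topology

/-- The algebra of the Jacobi identity: `aXY i j` stands for `Xᵢ Yⱼ F`, and `Yᵢ Xⱼ F` appears as
`aXY j i` because the fields commute. The summand is antisymmetric under exchange of `i` and `j`, so
the double sum equals its own negative. -/
theorem sum_jacobi_eq_zero {ι : Type*} [Fintype ι] (aX aY bX bY cX cY : ι → ℝ)
    (aXX aXY aYY bXX bXY bYY cXX cXY cYY : ι → ι → ℝ)
    (aXXs : ∀ i j, aXX i j = aXX j i) (bXXs : ∀ i j, bXX i j = bXX j i)
    (cXXs : ∀ i j, cXX i j = cXX j i) (aYYs : ∀ i j, aYY i j = aYY j i)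
    (bYYs : ∀ i j, bYY i j = bYY j i) (cYYs : ∀ i j, cYY i j = cYY j i) :
    ∑ i, ((∑ j, (aXX i j * bY j + aX j * bXY i j - (bXX i j * aY j + bX j * aXY i j))) * cY i
      - cX i * ∑ j, (aXY j i * bY j + aX j * bYY i j - (bXY j i * aY j + bX j * aYY i j)))
    + ∑ i, ((∑ j, (cXX i j * aY j + cX j * aXY i j - (aXX i j * cY j + aX j * cXY i j))) * bY i
      - bX i * ∑ j, (cXY j i * aY j + cX j * aYY i j - (aXY j i * cY j + aX j * cYY i j)))
    + ∑ i, ((∑ j, (bXX i j * cY j + bX j * cXY i j - (cXX i j * bY j + cX j * bXY i j))) * aY i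
      - aX i * ∑ j, (bXY j i * cY j + bX j * cYY i j - (cXY j i * bY j + cX j * bYY i j))) = 0 := by
  simp only [Finset.sum_mul, Finset.mul_sum, ← Finset.sum_sub_distrib, ← Finset.sum_add_distrib]
  set t : ι → ι → ℝ := fun i j => _ with ht
  change ∑ i, ∑ j, t i j = 0
  have h1 : ∑ i, ∑ j, t i j = ∑ i, ∑ j, t j i := Finset.sum_comm
  have h2 : ∑ i, ∑ j, t i j + ∑ i, ∑ j, t j i = 0 := by
    simp only [← Finset.sum_add_distrib]
    refine Finset.sum_eq_zero fun i _ => Finset.sum_eq_zero fun j _ => ?_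
    simp only [ht]
    rw [aXXs j i, bXXs j i, cXXs j i, aYYs j i, bYYs j i, cYYs j i]
    ring
  linarith

variable {Z : Type*} [NormedAddCommGroup Z] [NormedSpace ℝ Z]

/-- The bivector bracket `∑ i, Xᵢ ∧ Yᵢ`. -/
noncomputable def bivectorBracket {ι : Type*} [Fintype ι] (X Y : ι → Z → Z) (F G : Z → ℝ)
    (z : Z) : ℝ :=
  ∑ i, (fderiv ℝ F z (X i z) * fderiv ℝ G z (Y i z) - fderiv ℝ G z (X i z) * fderiv ℝ F z (Y i z))

theorem hasFDerivAt_fderiv_apply {F : Z → ℝ} {z : Z} {X : Z → Z} (hF : ContDiffAt ℝ ∞ F z)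
    (hX : DifferentiableAt ℝ X z) :
    ∃ L : Z →L[ℝ] ℝ, HasFDerivAt (fun y => fderiv ℝ F y (X y)) L z ∧
      ∀ v, L v = fderiv ℝ (fderiv ℝ F) z v (X z) + fderiv ℝ F z (fderiv ℝ X z v) := by
  have hF2 : HasFDerivAt (fderiv ℝ F) (fderiv ℝ (fderiv ℝ F) z) z :=
    ((hF.fderiv_right (m := 1) (by norm_cast)).differentiableAt (by simp)).hasFDerivAt
  exact ⟨_, hF2.clm_apply hX.hasFDerivAt, fun v => by simp [add_comm]⟩

/-- The bracket defined by pairwise commuting vector fields satisfies the Jacobi identity. -/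
theorem bivectorBracket_jacobi {ι : Type*} [Fintype ι] {X Y : ι → Z → Z} {F G H : Z → ℝ} {z : Z}
    (hX : ∀ i, DifferentiableAt ℝ (X i) z) (hY : ∀ i, DifferentiableAt ℝ (Y i) z)
    (hXX : ∀ i j, fderiv ℝ (X i) z (X j z) = fderiv ℝ (X j) z (X i z))
    (hXY : ∀ i j, fderiv ℝ (X i) z (Y j z) = fderiv ℝ (Y j) z (X i z))
    (hYY : ∀ i j, fderiv ℝ (Y i) z (Y j z) = fderiv ℝ (Y j) z (Y i z))
    (hF : ContDiffAt ℝ ∞ F z) (hG : ContDiffAt ℝ ∞ G z) (hH : ContDiffAt ℝ ∞ H z) :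
    bivectorBracket X Y (bivectorBracket X Y F G) H z
      + bivectorBracket X Y (bivectorBracket X Y H F) G z
      + bivectorBracket X Y (bivectorBracket X Y G H) F z = 0 := by
  have sym : ∀ {F : Z → ℝ}, ContDiffAt ℝ ∞ F z → IsSymmSndFDerivAt ℝ F z := fun hF =>
    hF.isSymmSndFDerivAt (by simp; norm_cast)
  have key : ∀ {F G : Z → ℝ}, ContDiffAt ℝ ∞ F z → ContDiffAt ℝ ∞ G z → ∀ v,
      fderiv ℝ (bivectorBracket X Y F G) z v = ∑ j,
        (((fderiv ℝ (fderiv ℝ F) z v (X j z) + fderiv ℝ F z (fderiv ℝ (X j) z v)) *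
            fderiv ℝ G z (Y j z) +
          fderiv ℝ F z (X j z) *
            (fderiv ℝ (fderiv ℝ G) z v (Y j z) + fderiv ℝ G z (fderiv ℝ (Y j) z v))) -
        ((fderiv ℝ (fderiv ℝ G) z v (X j z) + fderiv ℝ G z (fderiv ℝ (X j) z v)) *
            fderiv ℝ F z (Y j z) +
          fderiv ℝ G z (X j z) *
            (fderiv ℝ (fderiv ℝ F) z v (Y j z) + fderiv ℝ F z (fderiv ℝ (Y j) z v)))) := by
    intro F G hF hG v
    choose LX hLX hLXv using fun i => hasFDerivAt_fderiv_apply hF (hX i)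
    choose LY hLY hLYv using fun i => hasFDerivAt_fderiv_apply hF (hY i)
    choose MX hMX hMXv using fun i => hasFDerivAt_fderiv_apply hG (hX i)
    choose MY hMY hMYv using fun i => hasFDerivAt_fderiv_apply hG (hY i)
    have h : HasFDerivAt (bivectorBracket X Y F G) _ z := HasFDerivAt.fun_sum
      fun i (_ : i ∈ Finset.univ) => ((hLX i).mul (hMY i)).sub ((hMX i).mul (hLY i))
    rw [h.fderiv, sum_apply]
    refine Finset.sum_congr rfl fun i _ => ?_
    simp [hLXv, hLYv, hMXv, hMYv]
    ring
  -- `Yᵢ Xⱼ F = Xⱼ Yᵢ F`: symmetry of the second derivative together with `[Xⱼ, Yᵢ] = 0`.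
  have swap : ∀ {F : Z → ℝ}, ContDiffAt ℝ ∞ F z → ∀ i j,
      fderiv ℝ (fderiv ℝ F) z (Y i z) (X j z) + fderiv ℝ F z (fderiv ℝ (X j) z (Y i z)) =
      fderiv ℝ (fderiv ℝ F) z (X j z) (Y i z) + fderiv ℝ F z (fderiv ℝ (Y i) z (X j z)) :=
    fun hF i j => by rw [(sym hF).eq, hXY]
  unfold bivectorBracket at key ⊢
  simp only [key hF hG, key hH hF, key hG hH, swap hF, swap hG, swap hH]
  refine sum_jacobi_eq_zero (fun i => fderiv ℝ F z (X i z)) (fun i => fderiv ℝ F z (Y i z))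
    (fun i => fderiv ℝ G z (X i z)) (fun i => fderiv ℝ G z (Y i z))
    (fun i => fderiv ℝ H z (X i z)) (fun i => fderiv ℝ H z (Y i z))
    (fun i j => fderiv ℝ (fderiv ℝ F) z (X i z) (X j z) + fderiv ℝ F z (fderiv ℝ (X j) z (X i z)))
    (fun i j => fderiv ℝ (fderiv ℝ F) z (X i z) (Y j z) + fderiv ℝ F z (fderiv ℝ (Y j) z (X i z)))
    (fun i j => fderiv ℝ (fderiv ℝ F) z (Y i z) (Y j z) + fderiv ℝ F z (fderiv ℝ (Y j) z (Y i z)))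
    (fun i j => fderiv ℝ (fderiv ℝ G) z (X i z) (X j z) + fderiv ℝ G z (fderiv ℝ (X j) z (X i z)))
    (fun i j => fderiv ℝ (fderiv ℝ G) z (X i z) (Y j z) + fderiv ℝ G z (fderiv ℝ (Y j) z (X i z)))
    (fun i j => fderiv ℝ (fderiv ℝ G) z (Y i z) (Y j z) + fderiv ℝ G z (fderiv ℝ (Y j) z (Y i z)))
    (fun i j => fderiv ℝ (fderiv ℝ H) z (X i z) (X j z) + fderiv ℝ H z (fderiv ℝ (X j) z (X i z)))
    (fun i j => fderiv ℝ (fderiv ℝ H) z (X i z) (Y j z) + fderiv ℝ H z (fderiv ℝ (Y j) z (X i z)))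
    (fun i j => fderiv ℝ (fderiv ℝ H) z (Y i z) (Y j z) + fderiv ℝ H z (fderiv ℝ (Y j) z (Y i z)))
    ?_ ?_ ?_ ?_ ?_ ?_
  · exact fun i j => by rw [(sym hF).eq, hXX]
  · exact fun i j => by rw [(sym hG).eq, hXX]
  · exact fun i j => by rw [(sym hH).eq, hXX]
  · exact fun i j => by rw [(sym hF).eq, hYY]
  · exact fun i j => by rw [(sym hG).eq, hYY]
  · exact fun i j => by rw [(sym hH).eq, hYY]

variable {E : Type*} [NormedAddCommGroup E] [NormedSpace ℝ E] {r : ℕ}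

/-- The Lie bracket of the vector fields `B · u` and `B · v`, with the sign of the nonholonomic
bracket. -/
noncomputable def frameTorsion (B : E → EuclideanSpace ℝ (Fin r) →L[ℝ] E) (x : E)
    (u v : EuclideanSpace ℝ (Fin r)) : E :=
  fderiv ℝ B x (B x u) v - fderiv ℝ B x (B x v) u

/-- The bracket of functions on `D*`, in the coordinates of `D*` given by a frame `B` of `D` and the
coordinates `C` of the projection to `D`. -/
noncomputable def frameBracket (B : E → EuclideanSpace ℝ (Fin r) →L[ℝ] E)
    (C : E → E →L[ℝ] EuclideanSpace ℝ (Fin r)) (F G : E × CotangentModel r → ℝ)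
    (z : E × CotangentModel r) : ℝ :=
  fderiv ℝ F z (B z.1 (fiberVec (fderiv ℝ G z)), 0)
    - fderiv ℝ G z (B z.1 (fiberVec (fderiv ℝ F z)), 0)
    + z.2 (C z.1 (frameTorsion B z.1 (fiberVec (fderiv ℝ G z)) (fiberVec (fderiv ℝ F z))))

theorem frameBracket_eq_bivectorBracket {B : E → EuclideanSpace ℝ (Fin r) →L[ℝ] E}
    {C : E → E →L[ℝ] EuclideanSpace ℝ (Fin r)} {F G : E × CotangentModel r → ℝ}
    {z : E × CotangentModel r} (hT : ∀ u v, frameTorsion B z.1 u v = 0) :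
    frameBracket B C F G z = bivectorBracket
      (fun i z => (B z.1 (EuclideanSpace.single i 1), 0))
      (fun i _ => (0, EuclideanSpace.proj i)) F G z := by
  have h : ∀ (L : E × CotangentModel r →L[ℝ] ℝ)
      (v : EuclideanSpace ℝ (Fin r)), L (B z.1 v, 0) =
        ∑ a, v a * L (B z.1 (EuclideanSpace.single a 1), 0) :=
    fun L v => apply_eq_sum_proj (L ∘L ContinuousLinearMap.inl ℝ _ _ ∘L B z.1) v
  rw [frameBracket, bivectorBracket, hT, map_zero, map_zero, add_zero, h, h (fderiv ℝ G z),
    Finset.sum_sub_distrib]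
  simp only [fiberVec_apply, mul_comm]

/-- Zero torsion says exactly that the fields `B eᵢ` commute; they commute with the constant fields
`∂/∂pⱼ` since they depend on `x` only. The torsion must vanish on a neighbourhood, because the inner
bracket is differentiated. -/
theorem frameBracket_jacobi {B : E → EuclideanSpace ℝ (Fin r) →L[ℝ] E}
    {C : E → E →L[ℝ] EuclideanSpace ℝ (Fin r)} {F G H : E × CotangentModel r → ℝ}
    {z : E × CotangentModel r} (hB : DifferentiableAt ℝ B z.1)
    (hT : ∀ᶠ x in 𝓝 z.1, ∀ u v, frameTorsion B x u v = 0)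
    (hF : ContDiffAt ℝ ∞ F z) (hG : ContDiffAt ℝ ∞ G z) (hH : ContDiffAt ℝ ∞ H z) :
    frameBracket B C (frameBracket B C F G) H z
      + frameBracket B C (frameBracket B C H F) G z
      + frameBracket B C (frameBracket B C G H) F z = 0 := by
  have hBi : ∀ v, HasFDerivAt (fun z : E × CotangentModel r => ((B z.1 v, 0) : E × CotangentModel r))
      ((((ContinuousLinearMap.apply ℝ E v) ∘L (fderiv ℝ B z.1)) ∘L
        ContinuousLinearMap.fst ℝ _ _).prod 0) z := by
    intro v
    refine HasFDerivAt.prodMk ?_ (hasFDerivAt_const _ _)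
    exact (((ContinuousLinearMap.apply ℝ E v).hasFDerivAt).comp z.1 hB.hasFDerivAt).comp z
      hasFDerivAt_fst
  have key : ∀ F G H : E × CotangentModel r → ℝ,
      frameBracket B C (frameBracket B C F G) H z = bivectorBracket
        (fun i z => (B z.1 (EuclideanSpace.single i 1), 0))
        (fun i _ => (0, EuclideanSpace.proj i)) (bivectorBracket
        (fun i z => (B z.1 (EuclideanSpace.single i 1), 0))
        (fun i _ => (0, EuclideanSpace.proj i)) F G) H z := by
    intro F G H
    have h1 : frameBracket B C F G =ᶠ[𝓝 z] bivectorBracket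
        (fun i z => (B z.1 (EuclideanSpace.single i 1), 0))
        (fun i _ => (0, EuclideanSpace.proj i)) F G := by
      filter_upwards [continuousAt_fst.eventually hT] with y hy
      exact frameBracket_eq_bivectorBracket hy
    rw [frameBracket_eq_bivectorBracket hT.self_of_nhds]
    simp only [bivectorBracket, h1.fderiv_eq]
  rw [key, key, key]
  refine bivectorBracket_jacobi (fun i => (hBi _).differentiableAt)
    (fun i => differentiableAt_const _) (fun i j => ?_) (fun i j => ?_) (fun i j => ?_) hF hG hH
  · rw [(hBi _).fderiv, (hBi _).fderiv]
    have := hT.self_of_nhds (EuclideanSpace.single j 1) (EuclideanSpace.single i 1)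
    rw [frameTorsion, sub_eq_zero] at this
    simpa using this
  · rw [(hBi _).fderiv]; simp
  · simp

end LocalJacobi

/-! ### Vanishing of the torsion, from an integral manifold or from the Jacobi identity. -/

section LocalInvolutivity

open Filter
open scoped Topology

variable {E : Type*} [NormedAddCommGroup E] [NormedSpace ℝ E] {r : ℕ}

theorem frameBracket_congr {B : E → EuclideanSpace ℝ (Fin r) →L[ℝ] E}
    {C : E → E →L[ℝ] EuclideanSpace ℝ (Fin r)} {F F' G G' : E × CotangentModel r → ℝ}
    {z : E × CotangentModel r} (hF : F =ᶠ[𝓝 z] F') (hG : G =ᶠ[𝓝 z] G') :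
    frameBracket B C F G =ᶠ[𝓝 z] frameBracket B C F' G' := by
  filter_upwards [hF.fderiv (𝕜 := ℝ), hG.fderiv (𝕜 := ℝ)] with y hy hy'
  rw [frameBracket, frameBracket, hy, hy']

/-- Tangency means `f' = B(f) ∘ pr ∘ f'`. Differentiating, `f''(h, k) = B(pr f''(h, k)) + B'(f'
h)(pr (f' k))`. Symmetry of `f''` makes the last term symmetric, which is the claim for `v = pr (f'
h)` and `w = pr (f' k)`; every pair `v, w` has this form because `pr ∘ f'` is injective, hence
bijective. -/
theorem frameTorsion_eq_zero_of_integral {B : E → EuclideanSpace ℝ (Fin r) →L[ℝ] E}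
    {pr : E →L[ℝ] EuclideanSpace ℝ (Fin r)} {f : EuclideanSpace ℝ (Fin r) → E}
    {u₀ : EuclideanSpace ℝ (Fin r)} (hf : ContDiffAt ℝ ∞ f u₀) (hB : DifferentiableAt ℝ B (f u₀))
    (hpr : ∀ᶠ y in 𝓝 (f u₀), ∀ v, pr (B y v) = v)
    (hrange : ∀ᶠ u in 𝓝 u₀, ∀ h, fderiv ℝ f u h ∈ LinearMap.range (B (f u)).toLinearMap)
    (hinj : Function.Injective (fderiv ℝ f u₀)) (v w : EuclideanSpace ℝ (Fin r)) :
    frameTorsion B (f u₀) v w = 0 := by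
  have hfd : HasFDerivAt f (fderiv ℝ f u₀) u₀ := (hf.differentiableAt (by simp)).hasFDerivAt
  have hf2 : HasFDerivAt (fderiv ℝ f) (fderiv ℝ (fderiv ℝ f) u₀) u₀ :=
    ((hf.fderiv_right (m := 1) (by norm_cast)).differentiableAt (by simp)).hasFDerivAt
  have hsymm : IsSymmSndFDerivAt ℝ f u₀ := hf.isSymmSndFDerivAt (by simp; norm_cast)
  have heq : ∀ᶠ u in 𝓝 u₀, fderiv ℝ f u = B (f u) ∘L pr ∘L fderiv ℝ f u := by
    filter_upwards [hrange, hfd.continuousAt.eventually hpr] with u hu hu'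
    ext1 h
    obtain ⟨a, ha⟩ := hu h
    have ha' : B (f u) a = fderiv ℝ f u h := ha
    simp [← ha', hu']
  have hd : HasFDerivAt (fun u => B (f u) ∘L pr ∘L fderiv ℝ f u) _ u₀ :=
    (hB.hasFDerivAt.comp u₀ hfd).clm_comp ((hasFDerivAt_const pr u₀).clm_comp hf2)
  have h2 := hf2.unique (hd.congr_of_eventuallyEq heq)
  have h3 : ∀ h k, fderiv ℝ (fderiv ℝ f) u₀ h k = B (f u₀) (pr (fderiv ℝ (fderiv ℝ f) u₀ h k)) +
      fderiv ℝ B (f u₀) (fderiv ℝ f u₀ h) (pr (fderiv ℝ f u₀ k)) := fun h k => by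
    conv_lhs => rw [h2]
    simp
  have h4 : ∀ h, B (f u₀) (pr (fderiv ℝ f u₀ h)) = fderiv ℝ f u₀ h := fun h =>
    (DFunLike.congr_fun heq.self_of_nhds h).symm
  have hsurj : Function.Surjective (fun h => pr (fderiv ℝ f u₀ h)) := by
    refine LinearMap.injective_iff_surjective (f := (pr ∘L fderiv ℝ f u₀).toLinearMap).1 ?_
    intro a b hab
    refine hinj ?_
    have hab' : pr (fderiv ℝ f u₀ a) = pr (fderiv ℝ f u₀ b) := hab
    rw [← h4 a, ← h4 b, hab']
  obtain ⟨h, rfl⟩ := hsurj v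
  obtain ⟨k, rfl⟩ := hsurj w
  have e1 := h3 h k
  have e2 := h3 k h
  rw [hsymm.eq k h] at e2
  have e3 := e1.symm.trans e2
  simp only [frameTorsion, h4]
  rw [sub_eq_zero]
  exact add_left_cancel e3

/-- The brackets of the test functions are explicit: `{p(u), p(v)} = p(C T(v, u))`, `{l, p(u)} = l(B
u)`, `{p(v), l} = -l(B v)`. At `p = 0` their Jacobi sum is `l(T) - l(B C T)`, so `T = B C T` is
tangent to `D`, while `pr T = 0`. -/
theorem frameTorsion_eq_zero_of_jacobi {B : E → EuclideanSpace ℝ (Fin r) →L[ℝ] E}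
    {C : E → E →L[ℝ] EuclideanSpace ℝ (Fin r)}
    {pr : E →L[ℝ] EuclideanSpace ℝ (Fin r)} {x : E} (hB : ContDiffAt ℝ ∞ B x)
    (hC : DifferentiableAt ℝ C x) (hpr : ∀ᶠ y in 𝓝 x, ∀ v, pr (B y v) = v)
    {u v : EuclideanSpace ℝ (Fin r)}
    (hJ : ∀ l : E →L[ℝ] ℝ,
      frameBracket B C (frameBracket B C (fun z => z.2 u) (fun z => z.2 v)) (fun z => l z.1) (x, 0)
      + frameBracket B C (frameBracket B C (fun z => l z.1) (fun z => z.2 u)) (fun z => z.2 v) (x, 0)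
      + frameBracket B C (frameBracket B C (fun z => z.2 v) (fun z => l z.1)) (fun z => z.2 u) (x, 0)
      = 0) :
    frameTorsion B x v u = 0 := by
  have hBd : HasFDerivAt B (fderiv ℝ B x) x := (hB.differentiableAt (by simp)).hasFDerivAt
  have hB2 : DifferentiableAt ℝ (fderiv ℝ B) x :=
    (hB.fderiv_right (m := 1) (by norm_cast)).differentiableAt (by simp)
  have hT : DifferentiableAt ℝ (fun y => frameTorsion B y v u) x := by
    have h1 := hBd.differentiableAt
    unfold frameTorsion
    exact ((hB2.clm_apply (h1.clm_apply (differentiableAt_const v))).clm_apply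
      (differentiableAt_const u)).sub
      ((hB2.clm_apply (h1.clm_apply (differentiableAt_const u))).clm_apply
      (differentiableAt_const v))
  -- `pr (B y w)` is locally constant in `y`, so `pr` kills every derivative of `B`.
  have hprT : pr (frameTorsion B x v u) = 0 := by
    have h0 : ∀ w y, pr (fderiv ℝ B x y w) = 0 := by
      intro w y
      have h1 : HasFDerivAt (fun y => pr (B y w)) _ x :=
        pr.hasFDerivAt.comp x ((ContinuousLinearMap.apply ℝ E w).hasFDerivAt.comp x hBd)
      have h2 : HasFDerivAt (fun y => pr (B y w)) (0 : E →L[ℝ] _) x :=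
        (hasFDerivAt_const w x).congr_of_eventuallyEq (hpr.mono fun y hy => hy w)
      simpa using DFunLike.congr_fun (h1.unique h2) y
    rw [frameTorsion, map_sub, h0, h0, sub_zero]
  have dfib : ∀ (u : EuclideanSpace ℝ (Fin r)) (z : E × CotangentModel r),
      fderiv ℝ (fun z : E × CotangentModel r => z.2 u) z =
        (ContinuousLinearMap.apply ℝ ℝ u) ∘L ContinuousLinearMap.snd ℝ _ _ := fun u z =>
    ((ContinuousLinearMap.apply ℝ ℝ u) ∘L ContinuousLinearMap.snd ℝ E _).hasFDerivAt.fderiv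
  have dbase : ∀ (f : E → ℝ) (f' : E →L[ℝ] ℝ) (z : E × CotangentModel r), HasFDerivAt f f' z.1 →
      fderiv ℝ (fun z : E × CotangentModel r => f z.1) z = f' ∘L ContinuousLinearMap.fst ℝ _ _ :=
    fun f f' z h => (HasFDerivAt.comp z h hasFDerivAt_fst).fderiv
  have vfib : ∀ u : EuclideanSpace ℝ (Fin r), fiberVec (X := E)
      ((ContinuousLinearMap.apply ℝ ℝ u) ∘L ContinuousLinearMap.snd ℝ _ _) = u := fun u =>
    fiberVec_eq_of_forall fun p => by simp
  have vbase : ∀ l : E →L[ℝ] ℝ, fiberVec (r := r) (l ∘L ContinuousLinearMap.fst ℝ _ _) = 0 :=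
    fun l => fiberVec_eq_of_forall fun p => by simp
  have T0 : ∀ w y, frameTorsion B y 0 w = 0 ∧ frameTorsion B y w 0 = 0 := fun w y => by
    simp [frameTorsion]
  have b1 : frameBracket B C (fun z => z.2 u) (fun z => z.2 v) =
      fun z => z.2 (C z.1 (frameTorsion B z.1 v u)) := by
    ext z; simp [frameBracket, dfib, vfib]
  have b2 : ∀ l : E →L[ℝ] ℝ, frameBracket B C (fun z => l z.1) (fun z => z.2 u) =
      fun z => l (B z.1 u) := by
    intro l; ext z
    simp [frameBracket, dfib, dbase _ _ _ l.hasFDerivAt, vfib, vbase, (T0 _ _).2]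
  have b3 : ∀ l : E →L[ℝ] ℝ, frameBracket B C (fun z => z.2 v) (fun z => l z.1) =
      fun z => (-l) (B z.1 v) := by
    intro l; ext z
    simp [frameBracket, dfib, dbase _ _ _ l.hasFDerivAt, vfib, vbase, (T0 _ _).1]
  have hlB : ∀ (l : E →L[ℝ] ℝ) w, HasFDerivAt (fun y => l (B y w))
      (l ∘L (ContinuousLinearMap.apply ℝ E w) ∘L fderiv ℝ B x) x := fun l w =>
    l.hasFDerivAt.comp x ((ContinuousLinearMap.apply ℝ E w).hasFDerivAt.comp x hBd)
  have hfv : fiberVec (fderiv ℝ (fun z : E × CotangentModel r =>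
      z.2 (C z.1 (frameTorsion B z.1 v u))) (x, 0)) = C x (frameTorsion B x v u) := by
    refine fiberVec_eq_of_forall fun p => ?_
    have h1 : HasFDerivAt (fun y => C y (frameTorsion B y v u)) _ x :=
      (hC.clm_apply hT).hasFDerivAt
    have h2 := (hasFDerivAt_snd (𝕜 := ℝ) (p := ((x, 0) : E × CotangentModel r))).clm_apply
      (HasFDerivAt.comp (x, (0 : CotangentModel r)) h1 hasFDerivAt_fst)
    have h3 := h2.fderiv
    simp only [Function.comp_def] at h3
    rw [h3]
    simp
  -- Continuous functionals separate points, so it suffices to test against every `l`.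
  have hCT : frameTorsion B x v u = B x (C x (frameTorsion B x v u)) := by
    refine (SeparatingDual.eq_iff_forall_dual_eq (R := ℝ)).2 fun l => ?_
    have := hJ l
    rw [b1, b2, b3] at this
    simp only [frameBracket, hfv, dfib, vfib, dbase _ _ (x, (0 : CotangentModel r)) l.hasFDerivAt,
      vbase, dbase _ _ (x, (0 : CotangentModel r)) (hlB _ _)]
      at this
    simp [(T0 _ _).1, (T0 _ _).2, ← Prod.zero_eq_mk] at this
    rw [frameTorsion, map_sub]
    rw [frameTorsion] at this
    linarith
  have h5 := congrArg pr hCT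
  rw [hprT, hpr.self_of_nhds] at h5
  rw [hCT, ← h5, map_zero]

end LocalInvolutivity

/-! ### Canonical coordinates of `T*Q` in a fixed chart. -/

section CotangentCoordinates

open Filter
open scoped Topology

variable {n : ℕ} {Q : Type*} [TopologicalSpace Q] [ChartedSpace (EuclideanSpace ℝ (Fin n)) Q]
  [IsManifold (𝓡 n) ∞ Q]

/-- The differential at `q` of the preferred chart around `q₀`. -/
noncomputable def chartDifferential (q₀ q : Q) :
    TangentSpace (𝓡 n) q →L[ℝ] EuclideanSpace ℝ (Fin n) :=
  (trivializationAt (EuclideanSpace ℝ (Fin n)) (TangentSpace (𝓡 n) : Q → Type _)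
    q₀).continuousLinearMapAt ℝ q

/-- The inverse of `chartDifferential q₀ q`. -/
noncomputable def chartDifferentialSymm (q₀ q : Q) :
    EuclideanSpace ℝ (Fin n) →L[ℝ] TangentSpace (𝓡 n) q :=
  (trivializationAt (EuclideanSpace ℝ (Fin n)) (TangentSpace (𝓡 n) : Q → Type _) q₀).symmL ℝ q

theorem chartDifferentialSymm_apply_chartDifferential {q₀ q : Q}
    (h : q ∈ (extChartAt (𝓡 n) q₀).source) (v : TangentSpace (𝓡 n) q) :
    chartDifferentialSymm q₀ q (chartDifferential q₀ q v) = v := by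
  rw [extChartAt_source] at h
  exact Trivialization.symmL_continuousLinearMapAt (R := ℝ) _ h v

theorem chartDifferential_apply_chartDifferentialSymm {q₀ q : Q}
    (h : q ∈ (extChartAt (𝓡 n) q₀).source) (v : EuclideanSpace ℝ (Fin n)) :
    chartDifferential q₀ q (chartDifferentialSymm q₀ q v) = v := by
  rw [extChartAt_source] at h
  exact Trivialization.continuousLinearMapAt_symmL (R := ℝ) _ h v

theorem chartDifferential_eq_mfderiv {q₀ q : Q} (h : q ∈ (extChartAt (𝓡 n) q₀).source) :
    chartDifferential q₀ q =
      mfderiv (𝓡 n) 𝓘(ℝ, EuclideanSpace ℝ (Fin n)) (extChartAt (𝓡 n) q₀) q := by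
  rw [extChartAt_source] at h
  exact TangentBundle.continuousLinearMapAt_trivializationAt h

theorem contDiffAt_extChartAt_comp_symm {q₀ q₁ : Q} {x : EuclideanSpace ℝ (Fin n)}
    (hx : x ∈ (extChartAt (𝓡 n) q₀).target)
    (hx' : (extChartAt (𝓡 n) q₀).symm x ∈ (extChartAt (𝓡 n) q₁).source) :
    ContDiffAt ℝ ∞ (extChartAt (𝓡 n) q₁ ∘ (extChartAt (𝓡 n) q₀).symm) x := by
  rw [extChartAt_source] at hx'
  rw [← contMDiffAt_iff_contDiffAt]
  exact (contMDiffAt_extChartAt' hx').comp x ((contMDiffOn_extChartAt_symm q₀).contMDiffAt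
    ((isOpen_extChartAt_target q₀).mem_nhds hx))

theorem chartDifferential_eq_comp {q₀ q₁ q : Q} (h₀ : q ∈ (extChartAt (𝓡 n) q₀).source)
    (h₁ : q ∈ (extChartAt (𝓡 n) q₁).source) :
    chartDifferential q₁ q = fderiv ℝ (extChartAt (𝓡 n) q₁ ∘ (extChartAt (𝓡 n) q₀).symm)
      (extChartAt (𝓡 n) q₀ q) ∘L chartDifferential q₀ q := by
  ext1 v
  have h := tangentCoordChange_comp (I := 𝓡 n) (w := q) (x := q₀) (y := q₁) (z := q) (v := v)
    ⟨⟨mem_extChartAt_source q, h₀⟩, h₁⟩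
  have e : ∀ {q' : Q}, q ∈ (extChartAt (𝓡 n) q').source → ∀ v : TangentSpace (𝓡 n) q,
      chartDifferential q' q v = tangentCoordChange (𝓡 n) q q' q v := fun h' v => by
    rw [extChartAt_source] at h'
    exact DFunLike.congr_fun (TangentBundle.continuousLinearMapAt_trivializationAt_eq_core h') v
  have hd : tangentCoordChange (𝓡 n) q₀ q₁ q =
      fderiv ℝ (extChartAt (𝓡 n) q₁ ∘ (extChartAt (𝓡 n) q₀).symm) (extChartAt (𝓡 n) q₀ q) := by
    rw [tangentCoordChange_def, ← fderivWithin_univ]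
    simp
  rw [e h₁, ContinuousLinearMap.comp_apply, ← hd, e h₀]
  exact h.symm

/-- The covector with canonical coordinates `z` in the preferred chart around `q₀`. -/
noncomputable def cotangentMk (q₀ : Q) (z : EuclideanSpace ℝ (Fin n) × CotangentModel n) :
    Cotangent n Q :=
  ⟨(extChartAt (𝓡 n) q₀).symm z.1,
    z.2 ∘L chartDifferential q₀ ((extChartAt (𝓡 n) q₀).symm z.1)⟩

theorem cotangentMk_extChartAt {q₀ q : Q} (h : q ∈ (extChartAt (𝓡 n) q₀).source)
    (p : CotangentModel n) :
    cotangentMk q₀ (extChartAt (𝓡 n) q₀ q, p) = ⟨q, p ∘L chartDifferential q₀ q⟩ :=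
  congrArg (fun y : Q => (⟨y, p ∘L chartDifferential q₀ y⟩ : Cotangent n Q))
    ((extChartAt (𝓡 n) q₀).left_inv h)

theorem mem_cotangentChart_source {α₀ α : Cotangent n Q} :
    α ∈ (cotangentChart α₀).source ↔ α.proj ∈ (extChartAt (𝓡 n) α₀.proj).source := by
  rw [cotangentChart, extChartAt_source, extChartAt_source, FiberBundle.chartedSpace_chartAt]
  simp [hom_trivializationAt_source]
  exact fun h => h

theorem cotangentChart_cotangentMk (α₀ : Cotangent n Q)
    {z : EuclideanSpace ℝ (Fin n) × CotangentModel n}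
    (hz : z.1 ∈ (extChartAt (𝓡 n) α₀.proj).target) :
    cotangentChart α₀ (cotangentMk α₀.proj z) = z := by
  have hs : (cotangentMk α₀.proj z).proj ∈ (extChartAt (𝓡 n) α₀.proj).source :=
    (extChartAt (𝓡 n) α₀.proj).map_target hz
  obtain ⟨h1, h2⟩ := cotangentChart_apply α₀ (cotangentMk α₀.proj z)
    (by rw [← extChartAt_source (𝓡 n)]; exact hs)
  refine Prod.ext (h1.trans ((extChartAt (𝓡 n) α₀.proj).right_inv hz)) ?_
  ext1 w
  have h3 := h2 (chartDifferentialSymm α₀.proj _ w)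
  rw [← chartDifferential_eq_mfderiv hs] at h3
  erw [chartDifferential_apply_chartDifferentialSymm hs] at h3
  rw [h3]
  exact congrArg z.2 (chartDifferential_apply_chartDifferentialSymm hs w)

theorem cotangentChart_symm_apply (α₀ : Cotangent n Q)
    {z : EuclideanSpace ℝ (Fin n) × CotangentModel n}
    (hz : z.1 ∈ (extChartAt (𝓡 n) α₀.proj).target) :
    (cotangentChart α₀).symm z = cotangentMk α₀.proj z := by
  conv_lhs => rw [← cotangentChart_cotangentMk α₀ hz]
  exact (cotangentChart α₀).left_inv
    (mem_cotangentChart_source.2 ((extChartAt (𝓡 n) α₀.proj).map_target hz))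

theorem cotangentMk_injOn (q₀ : Q) {z z' : EuclideanSpace ℝ (Fin n) × CotangentModel n}
    (hz : z.1 ∈ (extChartAt (𝓡 n) q₀).target) (hz' : z'.1 ∈ (extChartAt (𝓡 n) q₀).target)
    (h : cotangentMk q₀ z = cotangentMk q₀ z') : z = z' := by
  rw [← cotangentChart_cotangentMk (⟨q₀, 0⟩ : Cotangent n Q) hz, h]
  exact cotangentChart_cotangentMk (⟨q₀, 0⟩ : Cotangent n Q) hz'

/-- The cotangent lift of a change of charts: momenta are composed with the derivative of the
inverse change. -/
theorem cotangentMk_eq_cotangentMk (q₀ q₁ : Q)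
    {z : EuclideanSpace ℝ (Fin n) × CotangentModel n}
    (hz : z.1 ∈ (extChartAt (𝓡 n) q₁).target)
    (hz' : (extChartAt (𝓡 n) q₁).symm z.1 ∈ (extChartAt (𝓡 n) q₀).source) :
    cotangentMk q₁ z = cotangentMk q₀ ((extChartAt (𝓡 n) q₀ ∘ (extChartAt (𝓡 n) q₁).symm) z.1,
      z.2 ∘L fderiv ℝ (extChartAt (𝓡 n) q₁ ∘ (extChartAt (𝓡 n) q₀).symm)
        ((extChartAt (𝓡 n) q₀ ∘ (extChartAt (𝓡 n) q₁).symm) z.1)) := by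
  rw [Function.comp_apply (f := extChartAt (𝓡 n) q₀), cotangentMk_extChartAt hz', cotangentMk,
    chartDifferential_eq_comp hz' ((extChartAt (𝓡 n) q₁).map_target hz)]
  rfl

/-- The canonical Poisson bracket may be computed in the canonical coordinates of any preferred
chart. -/
theorem canonicalPoissonBracket_cotangentMk (q₀ : Q) {φ ψ : Cotangent n Q → ℝ}
    {z : EuclideanSpace ℝ (Fin n) × CotangentModel n}
    (hz : z.1 ∈ (extChartAt (𝓡 n) q₀).target)
    (hφ : DifferentiableAt ℝ (φ ∘ cotangentMk q₀) z)
    (hψ : DifferentiableAt ℝ (ψ ∘ cotangentMk q₀) z) :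
    canonicalPoissonBracket φ ψ (cotangentMk q₀ z) =
      coordBracket (fderiv ℝ (φ ∘ cotangentMk q₀) z) (fderiv ℝ (ψ ∘ cotangentMk q₀) z) := by
  set α := cotangentMk q₀ z with hα
  have hq : α.proj ∈ (extChartAt (𝓡 n) q₀).source := (extChartAt (𝓡 n) q₀).map_target hz
  have hαs : α ∈ (cotangentChart α).source :=
    mem_cotangentChart_source.2 (mem_extChartAt_source α.proj)
  obtain ⟨x, p, hχ⟩ : ∃ x p, cotangentChart α α = (x, p) := ⟨_, _, rfl⟩
  have hx : x = extChartAt (𝓡 n) α.proj α.proj := by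
    rw [← (cotangentChart_apply α α (mem_chart_source _ _)).1, hχ]
  have hxt : x ∈ (extChartAt (𝓡 n) α.proj).target := hx ▸ mem_extChartAt_target α.proj
  have hxs : (extChartAt (𝓡 n) α.proj).symm x = α.proj := by rw [hx, extChartAt_to_inv]
  have hmk : cotangentMk α.proj (x, p) = α := by
    rw [← cotangentChart_symm_apply α hxt, ← hχ, (cotangentChart α).left_inv hαs]
  set τ := extChartAt (𝓡 n) q₀ ∘ (extChartAt (𝓡 n) α.proj).symm with hτ
  set σ := extChartAt (𝓡 n) α.proj ∘ (extChartAt (𝓡 n) q₀).symm with hσ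
  have hτx : τ x = extChartAt (𝓡 n) q₀ α.proj := by rw [hτ, Function.comp_apply, hxs]
  have hτs : (extChartAt (𝓡 n) q₀).symm (τ x) = α.proj := by
    rw [hτx, (extChartAt (𝓡 n) q₀).left_inv hq]
  have hτt : τ x ∈ (extChartAt (𝓡 n) q₀).target := hτx ▸ (extChartAt (𝓡 n) q₀).map_source hq
  -- The bracket is defined in the chart at `α` itself. Identifying the coordinates of `α` in the
  -- two charts reduces the claim to invariance under the cotangent lift of `τ`.
  have hzK : z = (τ x, p ∘L fderiv ℝ σ (τ x)) := by
    refine cotangentMk_injOn q₀ hz hτt ?_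
    rw [← hα]
    conv_lhs => rw [← hmk]
    exact cotangentMk_eq_cotangentMk q₀ α.proj (z := (x, p)) hxt (by rw [hxs]; exact hq)
  have hdom : ∀ᶠ y in 𝓝 x, y ∈ (extChartAt (𝓡 n) α.proj).target ∧
      (extChartAt (𝓡 n) α.proj).symm y ∈ (extChartAt (𝓡 n) q₀).source := by
    refine ((isOpen_extChartAt_target α.proj).eventually_mem hxt).and ?_
    refine (continuousAt_extChartAt_symm'' hxt).eventually
      ((isOpen_extChartAt_source q₀).eventually_mem ?_)
    rwa [hxs]
  have hΦ : ∀ φ : Cotangent n Q → ℝ, φ ∘ (cotangentChart α).symm =ᶠ[𝓝 (x, p)]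
      fun z => (φ ∘ cotangentMk q₀) (τ z.1, z.2 ∘L fderiv ℝ σ (τ z.1)) := by
    intro φ
    filter_upwards [continuousAt_fst.eventually hdom] with z hz
    rw [Function.comp_apply, cotangentChart_symm_apply α hz.1,
      cotangentMk_eq_cotangentMk q₀ α.proj hz.1 hz.2]
    rfl
  have hστ : σ ∘ τ =ᶠ[𝓝 x] id := by
    filter_upwards [hdom] with y hy
    simp only [hσ, hτ, Function.comp_apply, id]
    rw [(extChartAt (𝓡 n) q₀).left_inv hy.2, (extChartAt (𝓡 n) α.proj).right_inv hy.1]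
  have hcσ : ContDiffAt ℝ ∞ σ (τ x) := contDiffAt_extChartAt_comp_symm hτt (by
    rw [hτs]; exact mem_extChartAt_source α.proj)
  have hcτ : ContDiffAt ℝ ∞ τ x := contDiffAt_extChartAt_comp_symm hxt (by rwa [hxs])
  have hmain := coordBracket_fderiv_coordChange (hcτ.differentiableAt (by simp)) hcσ hστ
    (p := p) rfl (hzK ▸ hφ) (hzK ▸ hψ) (hΦ φ) (hΦ ψ)
  rw [← hzK] at hmain
  rw [← hmain, coordBracket_eq_sum, canonicalPoissonBracket]
  simp only [hχ]

end CotangentCoordinates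

/-! ### Local frames of `D` with a constant left inverse. -/

section AdaptedFrame

open Filter
open scoped Topology

variable {n r : ℕ} {Q : Type*} [TopologicalSpace Q] [ChartedSpace (EuclideanSpace ℝ (Fin n)) Q]
  [IsManifold (𝓡 n) ∞ Q]
  (D : ∀ q : Q, Submodule ℝ (TangentSpace (𝓡 n) q))
  [TopologicalSpace (TotalSpace (EuclideanSpace ℝ (Fin r)) (fun q : Q => D q))]
  [FiberBundle (EuclideanSpace ℝ (Fin r)) (fun q : Q => D q)]

/-- The local frame of `D` given by the preferred trivialization around `q₀`, in the coordinates of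
the preferred chart. -/
noncomputable def coordFrame (r : ℕ)
    [TopologicalSpace (TotalSpace (EuclideanSpace ℝ (Fin r)) (fun q : Q => D q))]
    [FiberBundle (EuclideanSpace ℝ (Fin r)) (fun q : Q => D q)]
    [VectorBundle ℝ (EuclideanSpace ℝ (Fin r)) (fun q : Q => D q)] (q₀ : Q)
    (x : EuclideanSpace ℝ (Fin n)) : EuclideanSpace ℝ (Fin r) →L[ℝ] EuclideanSpace ℝ (Fin n) :=
  chartDifferential q₀ ((extChartAt (𝓡 n) q₀).symm x) ∘L
    (D ((extChartAt (𝓡 n) q₀).symm x)).subtypeL ∘L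
    (trivializationAt (EuclideanSpace ℝ (Fin r)) (fun q : Q => D q) q₀).symmL ℝ
      ((extChartAt (𝓡 n) q₀).symm x)

/-- The domain of `coordFrame`. -/
def coordFrameDomain (r : ℕ)
    [TopologicalSpace (TotalSpace (EuclideanSpace ℝ (Fin r)) (fun q : Q => D q))]
    [FiberBundle (EuclideanSpace ℝ (Fin r)) (fun q : Q => D q)] (q₀ : Q) :
    Set (EuclideanSpace ℝ (Fin n)) :=
  (extChartAt (𝓡 n) q₀).target ∩ (extChartAt (𝓡 n) q₀).symm ⁻¹'
    (trivializationAt (EuclideanSpace ℝ (Fin r)) (fun q : Q => D q) q₀).baseSet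

omit [IsManifold (𝓡 n) ∞ Q] in
theorem isOpen_coordFrameDomain (q₀ : Q) : IsOpen (coordFrameDomain D r q₀) :=
  (continuousOn_extChartAt_symm q₀).isOpen_inter_preimage (isOpen_extChartAt_target q₀)
    (trivializationAt (EuclideanSpace ℝ (Fin r)) (fun q : Q => D q) q₀).open_baseSet

omit [IsManifold (𝓡 n) ∞ Q] in
theorem mem_coordFrameDomain (q₀ : Q) : extChartAt (𝓡 n) q₀ q₀ ∈ coordFrameDomain D r q₀ := by
  refine ⟨mem_extChartAt_target q₀, ?_⟩
  rw [mem_preimage, extChartAt_to_inv]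
  exact mem_baseSet_trivializationAt _ _ q₀

variable [VectorBundle ℝ (EuclideanSpace ℝ (Fin r)) (fun q : Q => D q)]

theorem coordFrame_apply (q₀ : Q) (x : EuclideanSpace ℝ (Fin n)) (v : EuclideanSpace ℝ (Fin r)) :
    coordFrame D r q₀ x v = chartDifferential q₀ ((extChartAt (𝓡 n) q₀).symm x)
      (((trivializationAt (EuclideanSpace ℝ (Fin r)) (fun q : Q => D q) q₀).symmL ℝ
        ((extChartAt (𝓡 n) q₀).symm x) v : D ((extChartAt (𝓡 n) q₀).symm x)) :
          TangentSpace (𝓡 n) ((extChartAt (𝓡 n) q₀).symm x)) :=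
  rfl

theorem chartDifferentialSymm_coordFrame {q₀ : Q} {x : EuclideanSpace ℝ (Fin n)}
    (hx : x ∈ coordFrameDomain D r q₀) (v : EuclideanSpace ℝ (Fin r)) :
    chartDifferentialSymm q₀ ((extChartAt (𝓡 n) q₀).symm x) (coordFrame D r q₀ x v) =
      (((trivializationAt (EuclideanSpace ℝ (Fin r)) (fun q : Q => D q) q₀).symmL ℝ
        ((extChartAt (𝓡 n) q₀).symm x) v : D ((extChartAt (𝓡 n) q₀).symm x)) :
          TangentSpace (𝓡 n) ((extChartAt (𝓡 n) q₀).symm x)) := by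
  rw [coordFrame_apply]
  exact chartDifferentialSymm_apply_chartDifferential ((extChartAt (𝓡 n) q₀).map_target hx.1) _

/-- A frame field is a smooth local section of `D`, carried into `TQ` by the smooth inclusion `hD`
and read in the trivialization of `TQ`. -/
theorem contDiffOn_coordFrame
    [ContMDiffVectorBundle ∞ (EuclideanSpace ℝ (Fin r)) (fun q : Q => D q) (𝓡 n)]
    (hD : ContMDiff ((𝓡 n).prod (𝓡 r)) (𝓡 n).tangent ∞
      (fun v : TotalSpace (EuclideanSpace ℝ (Fin r)) (fun q : Q => D q) =>
        (⟨v.proj, (v.2 : TangentSpace (𝓡 n) v.proj)⟩ : TangentBundle (𝓡 n) Q))) (q₀ : Q) :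
    ContDiffOn ℝ ∞ (coordFrame D r q₀) (coordFrameDomain D r q₀) := by
  rw [contDiffOn_clm_apply]
  intro v x hx
  set e := trivializationAt (EuclideanSpace ℝ (Fin r)) (fun q : Q => D q) q₀ with he
  set eT := trivializationAt (EuclideanSpace ℝ (Fin n)) (TangentSpace (𝓡 n) : Q → Type _) q₀ with heT
  set q := (extChartAt (𝓡 n) q₀).symm x with hq
  have hqs : q ∈ (extChartAt (𝓡 n) q₀).source := (extChartAt (𝓡 n) q₀).map_target hx.1
  have hqT : q ∈ eT.baseSet := by rw [extChartAt_source] at hqs; exact hqs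
  have hs : ContMDiffAt (𝓡 n) ((𝓡 n).prod (𝓡 r)) ∞
      (fun q => (⟨q, e.symmL ℝ q v⟩ : TotalSpace (EuclideanSpace ℝ (Fin r)) (fun q : Q => D q))) q := by
    rw [e.contMDiffAt_section_iff hx.2]
    refine (contMDiffAt_const (c := v)).congr_of_eventuallyEq ?_
    filter_upwards [e.open_baseSet.mem_nhds hx.2] with y hy
    rw [e.symmL_apply hy, e.apply_mk_symm hy]
  have hs' := (hD.contMDiffAt).comp q hs
  have hs'' : ContMDiffAt (𝓡 n) 𝓘(ℝ, EuclideanSpace ℝ (Fin n)) ∞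
      (fun q => (eT ⟨q, (e.symmL ℝ q v : TangentSpace (𝓡 n) q)⟩).2) q :=
    (eT.contMDiffAt_section_iff (s := fun q => (e.symmL ℝ q v : TangentSpace (𝓡 n) q)) hqT).1 hs'
  refine ContDiffAt.contDiffWithinAt ?_
  rw [← contMDiffAt_iff_contDiffAt]
  refine (hs''.comp x ((contMDiffOn_extChartAt_symm q₀).contMDiffAt
    ((isOpen_extChartAt_target q₀).mem_nhds hx.1))).congr_of_eventuallyEq ?_
  filter_upwards [(isOpen_extChartAt_target q₀).mem_nhds hx.1] with y hy
  have hyT : (extChartAt (𝓡 n) q₀).symm y ∈ eT.baseSet := by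
    have := (extChartAt (𝓡 n) q₀).map_target hy
    rw [extChartAt_source] at this; exact this
  change eT.continuousLinearMapAt ℝ _ _ = _
  rw [Trivialization.continuousLinearMapAt_apply, Trivialization.coe_linearMapAt_of_mem _ hyT]
  rfl

theorem mem_iff_mem_range_coordFrame {q₀ : Q} {x : EuclideanSpace ℝ (Fin n)}
    (hx : x ∈ coordFrameDomain D r q₀) (w : TangentSpace (𝓡 n) ((extChartAt (𝓡 n) q₀).symm x)) :
    w ∈ D ((extChartAt (𝓡 n) q₀).symm x) ↔
      chartDifferential q₀ _ w ∈ LinearMap.range (coordFrame D r q₀ x).toLinearMap := by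
  have hqs := (extChartAt (𝓡 n) q₀).map_target hx.1
  constructor
  · intro hw
    refine ⟨(trivializationAt (EuclideanSpace ℝ (Fin r)) (fun q : Q => D q) q₀).continuousLinearMapAt
      ℝ _ ⟨w, hw⟩, (coordFrame_apply D q₀ x _).trans ?_⟩
    rw [Trivialization.symmL_continuousLinearMapAt _ hx.2]
  · rintro ⟨v, hv⟩
    have h := congrArg (chartDifferentialSymm q₀ ((extChartAt (𝓡 n) q₀).symm x)) hv
    rw [chartDifferentialSymm_apply_chartDifferential hqs] at h
    rw [← (chartDifferentialSymm_coordFrame D hx v).symm.trans h]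
    exact Subtype.coe_prop _

theorem coordFrame_injective {q₀ : Q} {x : EuclideanSpace ℝ (Fin n)}
    (hx : x ∈ coordFrameDomain D r q₀) : Function.Injective (coordFrame D r q₀ x) := by
  intro v w hvw
  have h := congrArg (chartDifferentialSymm q₀ ((extChartAt (𝓡 n) q₀).symm x)) hvw
  rw [chartDifferentialSymm_coordFrame D hx, chartDifferentialSymm_coordFrame D hx] at h
  have h' := congrArg ((trivializationAt (EuclideanSpace ℝ (Fin r)) (fun q : Q => D q)
    q₀).continuousLinearMapAt ℝ _) (Subtype.coe_injective h)
  rwa [Trivialization.continuousLinearMapAt_symmL _ hx.2,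
    Trivialization.continuousLinearMapAt_symmL _ hx.2] at h'

/-- A local frame of `D` around `q₀` in the coordinates of the preferred chart, with a constant
left inverse. -/
structure AdaptedFrame (r : ℕ)
    [TopologicalSpace (TotalSpace (EuclideanSpace ℝ (Fin r)) (fun q : Q => D q))]
    [FiberBundle (EuclideanSpace ℝ (Fin r)) (fun q : Q => D q)] (q₀ : Q) where
  U : Set (EuclideanSpace ℝ (Fin n))
  isOpen_U : IsOpen U
  mem_U : extChartAt (𝓡 n) q₀ q₀ ∈ U
  U_subset : U ⊆ coordFrameDomain D r q₀
  B : EuclideanSpace ℝ (Fin n) → EuclideanSpace ℝ (Fin r) →L[ℝ] EuclideanSpace ℝ (Fin n)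
  contDiffOn_B : ContDiffOn ℝ ∞ B U
  pr : EuclideanSpace ℝ (Fin n) →L[ℝ] EuclideanSpace ℝ (Fin r)
  pr_B : ∀ x ∈ U, ∀ v, pr (B x v) = v
  mem_iff : ∀ x ∈ U, ∀ w : TangentSpace (𝓡 n) ((extChartAt (𝓡 n) q₀).symm x),
    w ∈ D ((extChartAt (𝓡 n) q₀).symm x) ↔
      chartDifferential q₀ _ w ∈ LinearMap.range (B x).toLinearMap

/-- Take for `pr` a left inverse of the frame at the single point `x₀`. Then `a x = pr ∘ frame x` is
the identity at `x₀`, hence invertible nearby, and `frame ∘ a⁻¹` is a frame of the same subspaces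
normalized by `pr`. -/
theorem nonempty_adaptedFrame
    [ContMDiffVectorBundle ∞ (EuclideanSpace ℝ (Fin r)) (fun q : Q => D q) (𝓡 n)]
    (hD : ContMDiff ((𝓡 n).prod (𝓡 r)) (𝓡 n).tangent ∞
      (fun v : TotalSpace (EuclideanSpace ℝ (Fin r)) (fun q : Q => D q) =>
        (⟨v.proj, (v.2 : TangentSpace (𝓡 n) v.proj)⟩ : TangentBundle (𝓡 n) Q))) (q₀ : Q) :
    Nonempty (AdaptedFrame D r q₀) := by
  set x₀ := extChartAt (𝓡 n) q₀ q₀ with hx₀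
  have hmem := mem_coordFrameDomain (r := r) D q₀
  obtain ⟨pr, hpr⟩ := LinearMap.exists_leftInverse_of_injective (coordFrame D r q₀ x₀).toLinearMap
    (LinearMap.ker_eq_bot.2 (coordFrame_injective D hmem))
  set P : EuclideanSpace ℝ (Fin n) →L[ℝ] EuclideanSpace ℝ (Fin r) := LinearMap.toContinuousLinearMap pr
  set a : EuclideanSpace ℝ (Fin n) → EuclideanSpace ℝ (Fin r) →L[ℝ] EuclideanSpace ℝ (Fin r) :=
    fun x => P ∘L coordFrame D r q₀ x with ha
  have hcf := contDiffOn_coordFrame D hD q₀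
  have hac : ContDiffOn ℝ ∞ a (coordFrameDomain D r q₀) := contDiffOn_const.clm_comp hcf
  have ha₀ : a x₀ = 1 := by
    ext1 v; exact DFunLike.congr_fun hpr v
  set U := coordFrameDomain D r q₀ ∩ a ⁻¹' {b | IsUnit b} with hU
  refine ⟨{
    U := U
    isOpen_U := hac.continuousOn.isOpen_inter_preimage (isOpen_coordFrameDomain D q₀) Units.isOpen
    mem_U := ⟨hmem, by rw [mem_preimage, ← hx₀, ha₀]; exact isUnit_one⟩
    U_subset := inter_subset_left
    B := fun x => coordFrame D r q₀ x ∘L Ring.inverse (a x)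
    contDiffOn_B := ?_
    pr := P
    pr_B := ?_
    mem_iff := ?_ }⟩
  · refine (hcf.mono inter_subset_left).clm_comp fun x hx => ?_
    obtain ⟨u, hu⟩ := hx.2
    have h1 : ContDiffAt ℝ ∞ Ring.inverse (a x) := by
      rw [← hu]; exact contDiffAt_ringInverse ℝ u
    exact h1.comp_contDiffWithinAt x ((hac x hx.1).mono inter_subset_left)
  · intro x hx v
    exact DFunLike.congr_fun (Ring.mul_inverse_cancel (a x) hx.2) v
  · intro x hx w
    rw [mem_iff_mem_range_coordFrame D hx.1]
    constructor
    · rintro ⟨v, hv⟩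
      refine ⟨a x v, ?_⟩
      rw [← hv]
      exact congrArg (coordFrame D r q₀ x)
        (DFunLike.congr_fun (Ring.inverse_mul_cancel (a x) hx.2) v)
    · rintro ⟨v, hv⟩
      exact ⟨Ring.inverse (a x) v, hv⟩

end AdaptedFrame

/-! ### The nonholonomic bracket in an adapted frame. -/

section AdaptedCoordinates

open Filter
open scoped Topology

variable {n r : ℕ} {Q : Type*} [TopologicalSpace Q] [ChartedSpace (EuclideanSpace ℝ (Fin n)) Q]
  [IsManifold (𝓡 n) ∞ Q]
  (g : ContMDiffRiemannianMetric (𝓡 n) ∞ (EuclideanSpace ℝ (Fin n))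
    (fun q : Q => TangentSpace (𝓡 n) q))

theorem orthProjection_apply_of_mem (D : ∀ q : Q, Submodule ℝ (TangentSpace (𝓡 n) q)) {q : Q}
    {v : TangentSpace (𝓡 n) q} (hv : v ∈ D q) : orthProjection g D q v = ⟨v, hv⟩ :=
  Submodule.projectionOnto_apply_of_mem_left (isCompl_metricOrthogonal g D q) hv

theorem sub_orthProjection_mem (D : ∀ q : Q, Submodule ℝ (TangentSpace (𝓡 n) q)) {q : Q}
    (v : TangentSpace (𝓡 n) q) : v - orthProjection g D q v ∈ metricOrthogonal g D q := by
  rw [← Submodule.projectionOnto_apply_eq_zero_iff (isCompl_metricOrthogonal g D q)]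
  change orthProjection g D q (v - orthProjection g D q v) = 0
  rw [map_sub, orthProjection_apply_of_mem g D (Subtype.coe_prop (orthProjection g D q v))]
  exact sub_self _

theorem contDiffAt_metric_chartDifferentialSymm {q₀ : Q} {x : EuclideanSpace ℝ (Fin n)}
    (hx : x ∈ (extChartAt (𝓡 n) q₀).target)
    {a b : EuclideanSpace ℝ (Fin n) → EuclideanSpace ℝ (Fin n)} (ha : ContDiffAt ℝ ∞ a x)
    (hb : ContDiffAt ℝ ∞ b x) :
    ContDiffAt ℝ ∞ (fun y => g.inner ((extChartAt (𝓡 n) q₀).symm y)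
      (chartDifferentialSymm q₀ _ (a y)) (chartDifferentialSymm q₀ _ (b y))) x := by
  have hsymm : ContMDiffAt 𝓘(ℝ, EuclideanSpace ℝ (Fin n)) (𝓡 n) ∞ (extChartAt (𝓡 n) q₀).symm x :=
    (contMDiffOn_extChartAt_symm q₀).contMDiffAt ((isOpen_extChartAt_target q₀).mem_nhds hx)
  have hmem : ∀ y ∈ (extChartAt (𝓡 n) q₀).target, (extChartAt (𝓡 n) q₀).symm y ∈
      (trivializationAt (EuclideanSpace ℝ (Fin n)) (TangentSpace (𝓡 n) : Q → Type _) q₀).baseSet :=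
    fun y hy => by
      have := (extChartAt (𝓡 n) q₀).map_target hy
      rw [extChartAt_source] at this; exact this
  have hsec : ∀ {a : EuclideanSpace ℝ (Fin n) → EuclideanSpace ℝ (Fin n)}, ContDiffAt ℝ ∞ a x →
      ContMDiffAt 𝓘(ℝ, EuclideanSpace ℝ (Fin n)) ((𝓡 n).prod (𝓡 n)) ∞
        (fun y => (⟨(extChartAt (𝓡 n) q₀).symm y, chartDifferentialSymm q₀ _ (a y)⟩ :
          TangentBundle (𝓡 n) Q)) x := by
    intro a ha
    rw [(trivializationAt (EuclideanSpace ℝ (Fin n)) (TangentSpace (𝓡 n) : Q → Type _)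
      q₀).contMDiffAt_iff (by rw [Trivialization.mem_source]; exact hmem x hx)]
    refine ⟨hsymm, ha.contMDiffAt.congr_of_eventuallyEq ?_⟩
    filter_upwards [(isOpen_extChartAt_target q₀).mem_nhds hx] with y hy
    rw [chartDifferentialSymm, Trivialization.symmL_apply _ (hmem y hy),
      Trivialization.apply_mk_symm _ (hmem y hy)]
  have h := ContMDiffAt.clm_bundle_apply₂ (F₁ := EuclideanSpace ℝ (Fin n))
    (F₂ := EuclideanSpace ℝ (Fin n)) (F₃ := ℝ) (E₃ := Bundle.Trivial Q ℝ)
    (b := (extChartAt (𝓡 n) q₀).symm) (x := x)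
    (ψ := fun y => g.inner ((extChartAt (𝓡 n) q₀).symm y))
    ((g.contMDiff _).comp x hsymm) (hsec ha) (hsec hb)
  rw [contMDiffAt_totalSpace] at h
  exact contMDiffAt_iff_contDiffAt.1 h.2

variable {D : ∀ q : Q, Submodule ℝ (TangentSpace (𝓡 n) q)}
  [TopologicalSpace (TotalSpace (EuclideanSpace ℝ (Fin r)) (fun q : Q => D q))]
  [FiberBundle (EuclideanSpace ℝ (Fin r)) (fun q : Q => D q)]

namespace AdaptedFrame

variable {q₀ : Q} (A : AdaptedFrame D r q₀)

include A in
theorem mem_target {x : EuclideanSpace ℝ (Fin n)} (hx : x ∈ A.U) :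
    x ∈ (extChartAt (𝓡 n) q₀).target :=
  (A.U_subset hx).1

theorem mem_source {x : EuclideanSpace ℝ (Fin n)} (hx : x ∈ A.U) :
    (extChartAt (𝓡 n) q₀).symm x ∈ (extChartAt (𝓡 n) q₀).source :=
  (extChartAt (𝓡 n) q₀).map_target (A.mem_target hx)

theorem contDiffAt_B {x : EuclideanSpace ℝ (Fin n)} (hx : x ∈ A.U) : ContDiffAt ℝ ∞ A.B x :=
  A.contDiffOn_B.contDiffAt (A.isOpen_U.mem_nhds hx)

theorem B_pr_chartDifferential {x : EuclideanSpace ℝ (Fin n)} (hx : x ∈ A.U)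
    (w : D ((extChartAt (𝓡 n) q₀).symm x)) :
    A.B x (A.pr (chartDifferential q₀ _ (w : TangentSpace (𝓡 n) ((extChartAt (𝓡 n) q₀).symm x)))) =
      chartDifferential q₀ _ (w : TangentSpace (𝓡 n) ((extChartAt (𝓡 n) q₀).symm x)) := by
  obtain ⟨v, hv⟩ := (A.mem_iff x hx w).1 w.2
  have hv' : A.B x v = chartDifferential q₀ _ (w : TangentSpace (𝓡 n) ((extChartAt (𝓡 n) q₀).symm x)) := hv
  rw [← hv', A.pr_B x hx]

theorem chartDifferentialSymm_B_mem {x : EuclideanSpace ℝ (Fin n)} (hx : x ∈ A.U)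
    (v : EuclideanSpace ℝ (Fin r)) :
    chartDifferentialSymm q₀ _ (A.B x v) ∈ D ((extChartAt (𝓡 n) q₀).symm x) := by
  rw [A.mem_iff x hx, chartDifferential_apply_chartDifferentialSymm (A.mem_source hx)]
  exact ⟨v, rfl⟩

/-- The element of `D*` with coordinates `z` in the adapted frame. -/
noncomputable def dualMk (z : EuclideanSpace ℝ (Fin n) × CotangentModel r) :
    DualDistribution r D :=
  ⟨(extChartAt (𝓡 n) q₀).symm z.1, z.2 ∘L A.pr ∘L
    chartDifferential q₀ ((extChartAt (𝓡 n) q₀).symm z.1) ∘L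
      (D ((extChartAt (𝓡 n) q₀).symm z.1)).subtypeL⟩

/-- The orthogonal projection to `D` in the coordinates of the adapted frame. -/
noncomputable def projCoord (x : EuclideanSpace ℝ (Fin n)) :
    EuclideanSpace ℝ (Fin n) →L[ℝ] EuclideanSpace ℝ (Fin r) :=
  A.pr ∘L chartDifferential q₀ ((extChartAt (𝓡 n) q₀).symm x) ∘L
    (D ((extChartAt (𝓡 n) q₀).symm x)).subtypeL ∘L
    orthProjection g D ((extChartAt (𝓡 n) q₀).symm x) ∘L
    chartDifferentialSymm q₀ ((extChartAt (𝓡 n) q₀).symm x)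

theorem projCoord_apply (x w : EuclideanSpace ℝ (Fin n)) :
    A.projCoord g x w = A.pr (chartDifferential q₀ _
      (orthProjection g D ((extChartAt (𝓡 n) q₀).symm x) (chartDifferentialSymm q₀ _ w) :
        TangentSpace (𝓡 n) ((extChartAt (𝓡 n) q₀).symm x))) :=
  rfl

theorem projCoord_B {x : EuclideanSpace ℝ (Fin n)} (hx : x ∈ A.U) (v : EuclideanSpace ℝ (Fin r)) :
    A.projCoord g x (A.B x v) = v := by
  rw [projCoord_apply, orthProjection_apply_of_mem g D (A.chartDifferentialSymm_B_mem hx v)]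
  change A.pr (chartDifferential q₀ _ (chartDifferentialSymm q₀ _ (A.B x v))) = v
  rw [chartDifferential_apply_chartDifferentialSymm (A.mem_source hx), A.pr_B x hx]

theorem inclusionDual_cotangentMk {x : EuclideanSpace ℝ (Fin n)} (hx : x ∈ A.U)
    (p : CotangentModel n) :
    (inclusionDual D (cotangentMk q₀ (x, p)) : DualDistribution r D) =
      A.dualMk (x, p ∘L A.B x) := by
  refine congrArg (TotalSpace.mk' (CotangentModel r) (E := fun q : Q => D q →L[ℝ] ℝ)
    ((extChartAt (𝓡 n) q₀).symm x)) ?_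
  ext w
  exact congrArg p (A.B_pr_chartDifferential hx w).symm

theorem projectionDual_dualMk {x : EuclideanSpace ℝ (Fin n)} (hx : x ∈ A.U)
    (p : CotangentModel r) :
    projectionDual g D (A.dualMk (x, p)) = cotangentMk q₀ (x, p ∘L A.projCoord g x) := by
  have h : ∀ w : TangentSpace (𝓡 n) ((extChartAt (𝓡 n) q₀).symm x),
      p (A.pr (chartDifferential q₀ _ (orthProjection g D ((extChartAt (𝓡 n) q₀).symm x) w :
        TangentSpace (𝓡 n) ((extChartAt (𝓡 n) q₀).symm x)))) =
      p (A.projCoord g x (chartDifferential q₀ _ w)) := fun w => by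
    rw [projCoord_apply, chartDifferentialSymm_apply_chartDifferential (A.mem_source hx)]
  refine congrArg (TotalSpace.mk' (CotangentModel n)
    (E := fun q : Q => TangentSpace (𝓡 n) q →L[ℝ] ℝ) ((extChartAt (𝓡 n) q₀).symm x)) ?_
  ext w
  exact h w

/-- The nonholonomic bracket in the coordinates of the adapted frame. -/
theorem nonholonomicBracket_dualMk {φ ψ : DualDistribution r D → ℝ}
    {z : EuclideanSpace ℝ (Fin n) × CotangentModel r} (hz : z.1 ∈ A.U)
    (hφ : DifferentiableAt ℝ (φ ∘ A.dualMk) z) (hψ : DifferentiableAt ℝ (ψ ∘ A.dualMk) z) :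
    nonholonomicBracket g D φ ψ (A.dualMk z) =
      frameBracket A.B (A.projCoord g) (φ ∘ A.dualMk) (ψ ∘ A.dualMk) z := by
  obtain ⟨x, p⟩ := z
  have hz' : x ∈ A.U := hz
  -- This is `i_D^* ∘ 𝒫^* = id`: the derivatives of `φ` and `ψ` are evaluated at the original point
  -- of `D*`.
  have hpB : (p ∘L A.projCoord g x) ∘L A.B x = p := by
    ext1 v; exact congrArg p (A.projCoord_B g hz' v)
  have hloc : ∀ φ : DualDistribution r D → ℝ,
      (φ ∘ inclusionDual D) ∘ cotangentMk q₀ =ᶠ[𝓝 (x, p ∘L A.projCoord g x)]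
        fun z => (φ ∘ A.dualMk) (id z.1, z.2 ∘L A.B z.1) := by
    intro φ
    filter_upwards [continuousAt_fst.eventually (A.isOpen_U.eventually_mem hz')] with y hy
    exact congrArg φ (A.inclusionDual_cotangentMk hy y.2)
  -- Pullback formula with `τ = id` and the frame as `B`: the second-order term is now the torsion,
  -- paired with `p ∘ C`.
  have hBd := ((A.contDiffAt_B hz').differentiableAt (by simp)).hasFDerivAt
  obtain ⟨d1, d2, h⟩ := coordBracket_fderiv_pullback (hasFDerivAt_id x) hBd
    (p := p ∘L A.projCoord g x) (F := φ ∘ A.dualMk) (G := ψ ∘ A.dualMk)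
    (by rw [hpB]; exact hφ) (by rw [hpB]; exact hψ) (hloc φ) (hloc ψ)
  rw [nonholonomicBracket, Function.comp_apply, projectionDual_dualMk g A hz',
    canonicalPoissonBracket_cotangentMk q₀ (A.mem_target hz') d1 d2, h]
  simp only [hpB, id]
  rfl

/-- Normal equations of the orthogonal projection: with `N w = (g(B eₐ, w))ₐ` and the Gram matrix `M
= N ∘ B`, one has `M ∘ C = N`. Hence `C = M⁻¹ N` is smooth. -/
theorem contDiffOn_projCoord : ContDiffOn ℝ ∞ (A.projCoord g) A.U := by
  set N : EuclideanSpace ℝ (Fin n) → EuclideanSpace ℝ (Fin n) →L[ℝ] EuclideanSpace ℝ (Fin r) :=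
    fun x => ∑ a, (g.inner ((extChartAt (𝓡 n) q₀).symm x)
      (chartDifferentialSymm q₀ _ (A.B x (EuclideanSpace.single a 1))) ∘L
        chartDifferentialSymm q₀ ((extChartAt (𝓡 n) q₀).symm x)).smulRight
          (EuclideanSpace.single a (1 : ℝ)) with hN
  have hNa : ∀ x w, N x w = ∑ a, g.inner ((extChartAt (𝓡 n) q₀).symm x)
      (chartDifferentialSymm q₀ _ (A.B x (EuclideanSpace.single a 1)))
        (chartDifferentialSymm q₀ _ w) • EuclideanSpace.single a (1 : ℝ) := by
    intro x w
    rw [hN, sum_apply]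
    rfl
  have hNc : ∀ x w a, N x w a = g.inner ((extChartAt (𝓡 n) q₀).symm x)
      (chartDifferentialSymm q₀ _ (A.B x (EuclideanSpace.single a 1)))
        (chartDifferentialSymm q₀ _ w) := by
    intro x w a
    rw [hNa]
    simp [Pi.single_apply]
  have hNs : ContDiffOn ℝ ∞ N A.U := by
    rw [contDiffOn_clm_apply]
    intro w x hx
    refine ContDiffAt.contDiffWithinAt ?_
    simp only [hNa]
    refine ContDiffAt.sum fun a _ => ContDiffAt.fun_smul ?_ contDiffAt_const
    exact contDiffAt_metric_chartDifferentialSymm g (A.mem_target hx)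
      ((A.contDiffAt_B hx).clm_apply contDiffAt_const) contDiffAt_const
  set M : EuclideanSpace ℝ (Fin n) → EuclideanSpace ℝ (Fin r) →L[ℝ] EuclideanSpace ℝ (Fin r) :=
    fun x => N x ∘L A.B x with hM
  have hMs : ContDiffOn ℝ ∞ M A.U := hNs.clm_comp A.contDiffOn_B
  -- A kernel vector `u` of the Gram matrix satisfies `g(B u, B u) = 0`, so `B u = 0` and `u = pr (B
  -- u) = 0`.
  have hMu : ∀ x ∈ A.U, IsUnit (M x) := by
    intro x hx
    rw [ContinuousLinearMap.isUnit_iff_bijective]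
    have hinj : Function.Injective (M x).toLinearMap := by
      rw [injective_iff_map_eq_zero]
      intro u hu
      have h1 : ∀ a, g.inner ((extChartAt (𝓡 n) q₀).symm x)
          (chartDifferentialSymm q₀ _ (A.B x (EuclideanSpace.single a 1)))
            (chartDifferentialSymm q₀ _ (A.B x u)) = 0 := by
        intro a
        rw [← hNc]
        exact congrArg (fun y : EuclideanSpace ℝ (Fin r) => y a) hu
      have h2 : g.inner ((extChartAt (𝓡 n) q₀).symm x)
          (chartDifferentialSymm q₀ _ (A.B x u)) (chartDifferentialSymm q₀ _ (A.B x u)) = 0 := by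
        rw [g.symm]
        have h3 := apply_eq_sum_proj (g.inner ((extChartAt (𝓡 n) q₀).symm x)
          (chartDifferentialSymm q₀ _ (A.B x u)) ∘L chartDifferentialSymm q₀ _ ∘L A.B x) u
        refine h3.trans (Finset.sum_eq_zero fun a _ => ?_)
        rw [show (g.inner ((extChartAt (𝓡 n) q₀).symm x) (chartDifferentialSymm q₀ _ (A.B x u)) ∘L
          chartDifferentialSymm q₀ _ ∘L A.B x) (EuclideanSpace.single a 1) = 0 from
            (g.symm _ _ _).trans (h1 a), mul_zero]
      have h4 : chartDifferentialSymm q₀ ((extChartAt (𝓡 n) q₀).symm x) (A.B x u) = 0 := by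
        by_contra hne
        exact (g.pos _ _ hne).ne' h2
      have h5 := congrArg (chartDifferential q₀ ((extChartAt (𝓡 n) q₀).symm x)) h4
      rw [chartDifferential_apply_chartDifferentialSymm (A.mem_source hx), map_zero] at h5
      rw [← A.pr_B x hx u, h5, map_zero]
    exact ⟨hinj, LinearMap.injective_iff_surjective.1 hinj⟩
  -- `w` and its projection have the same inner products with vectors of `D`.
  have hMC : ∀ x ∈ A.U, ∀ w, M x (A.projCoord g x w) = N x w := by
    intro x hx w
    have h1 : chartDifferentialSymm q₀ _ (A.B x (A.projCoord g x w)) =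
        (orthProjection g D ((extChartAt (𝓡 n) q₀).symm x) (chartDifferentialSymm q₀ _ w) :
          TangentSpace (𝓡 n) ((extChartAt (𝓡 n) q₀).symm x)) := by
      rw [projCoord_apply, A.B_pr_chartDifferential hx]
      exact chartDifferentialSymm_apply_chartDifferential (A.mem_source hx) _
    ext a
    rw [hM, ContinuousLinearMap.comp_apply, hNc, hNc, h1, ← sub_eq_zero, ← map_sub, g.symm,
      ← neg_sub, map_neg, neg_apply, neg_eq_zero]
    exact sub_orthProjection_mem g D _ _ (A.chartDifferentialSymm_B_mem hx _)
  have hinv : ContDiffOn ℝ ∞ (fun x => Ring.inverse (M x) ∘L N x) A.U := by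
    refine ContDiffOn.clm_comp (fun x hx => ?_) hNs
    obtain ⟨u, hu⟩ := hMu x hx
    have h1 : ContDiffAt ℝ ∞ Ring.inverse (M x) := by
      rw [← hu]; exact contDiffAt_ringInverse ℝ u
    exact h1.comp_contDiffWithinAt x (hMs x hx)
  refine hinv.congr fun x hx => ?_
  ext1 w
  rw [ContinuousLinearMap.comp_apply, ← hMC x hx w]
  exact (DFunLike.congr_fun (Ring.inverse_mul_cancel (M x) (hMu x hx)) (A.projCoord g x w)).symm

end AdaptedFrame

end AdaptedCoordinates

/-! ### Smoothness of the bracket, needed to iterate it. -/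

section FrameBracketSmooth

variable {E : Type*} [NormedAddCommGroup E] [NormedSpace ℝ E] {r : ℕ}

set_option synthInstance.maxHeartbeats 200000 in
theorem contDiffAt_frameBracket {B : E → EuclideanSpace ℝ (Fin r) →L[ℝ] E}
    {C : E → E →L[ℝ] EuclideanSpace ℝ (Fin r)} {F G : E × CotangentModel r → ℝ}
    {z : E × CotangentModel r} (hB : ContDiffAt ℝ ∞ B z.1) (hC : ContDiffAt ℝ ∞ C z.1)
    (hF : ContDiffAt ℝ ∞ F z) (hG : ContDiffAt ℝ ∞ G z) :
    ContDiffAt ℝ ∞ (frameBracket B C F G) z := by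
  have hF' : ContDiffAt ℝ ∞ (fderiv ℝ F) z := hF.fderiv_right (by norm_cast)
  have hG' : ContDiffAt ℝ ∞ (fderiv ℝ G) z := hG.fderiv_right (by norm_cast)
  have hf : ContDiffAt ℝ ∞ (fun z => fiberVec (fderiv ℝ F z)) z :=
    ContDiffAt.clm_apply contDiffAt_const hF'
  have hg : ContDiffAt ℝ ∞ (fun z => fiberVec (fderiv ℝ G z)) z :=
    ContDiffAt.clm_apply contDiffAt_const hG'
  have hBz : ContDiffAt ℝ ∞ (fun z : E × CotangentModel r => B z.1) z := hB.comp z contDiffAt_fst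
  have hCz : ContDiffAt ℝ ∞ (fun z : E × CotangentModel r => C z.1) z := hC.comp z contDiffAt_fst
  have hB'z : ContDiffAt ℝ ∞ (fun z : E × CotangentModel r => fderiv ℝ B z.1) z :=
    (hB.fderiv_right (by norm_cast)).comp z contDiffAt_fst
  have hBf := hBz.clm_apply hf
  have hBg := hBz.clm_apply hg
  exact ((hF'.clm_apply (hBg.prodMk contDiffAt_const)).sub
    (hG'.clm_apply (hBf.prodMk contDiffAt_const))).add
      (contDiffAt_snd.clm_apply (hCz.clm_apply
        (((hB'z.clm_apply hBg).clm_apply hf).sub ((hB'z.clm_apply hBf).clm_apply hg))))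

end FrameBracketSmooth

/-! ### Smooth functions on `D*` in adapted coordinates, and cutoffs. -/

section DualCoordinates

open Filter
open scoped Topology

variable {n r : ℕ} {Q : Type*} [TopologicalSpace Q] [ChartedSpace (EuclideanSpace ℝ (Fin n)) Q]
  [IsManifold (𝓡 n) ∞ Q]
  (g : ContMDiffRiemannianMetric (𝓡 n) ∞ (EuclideanSpace ℝ (Fin n))
    (fun q : Q => TangentSpace (𝓡 n) q))
  {D : ∀ q : Q, Submodule ℝ (TangentSpace (𝓡 n) q)}
  [TopologicalSpace (TotalSpace (EuclideanSpace ℝ (Fin r)) (fun q : Q => D q))]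
  [FiberBundle (EuclideanSpace ℝ (Fin r)) (fun q : Q => D q)]
  [VectorBundle ℝ (EuclideanSpace ℝ (Fin r)) (fun q : Q => D q)]

/-- The fibre coordinates of `D*` in the preferred trivialization around `q₀`. -/
noncomputable def dualFiberCoord (q₀ : Q) (β : DualDistribution r D) : CotangentModel r :=
  (trivializationAt (CotangentModel r) (fun q : Q => D q →L[ℝ] ℝ) q₀ β).2

omit [IsManifold (𝓡 n) ∞ Q] in
theorem dualFiberCoord_apply (q₀ : Q) (β : DualDistribution r D) :
    dualFiberCoord q₀ β = β.2 ∘L (trivializationAt (EuclideanSpace ℝ (Fin r))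
      (fun q : Q => D q) q₀).symmL ℝ β.proj := by
  ext v
  simp [dualFiberCoord, hom_trivializationAt_apply, ContinuousLinearMap.inCoordinates]

omit [IsManifold (𝓡 n) ∞ Q] in
theorem mem_dualTrivialization_source {q₀ : Q} {β : DualDistribution r D}
    (hβ : β.proj ∈ (trivializationAt (EuclideanSpace ℝ (Fin r)) (fun q : Q => D q) q₀).baseSet) :
    β ∈ (trivializationAt (CotangentModel r) (fun q : Q => D q →L[ℝ] ℝ) q₀).source := by
  rw [Trivialization.mem_source, hom_trivializationAt_baseSet]
  exact ⟨hβ, mem_univ _⟩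

namespace AdaptedFrame

variable {q₀ : Q} (A : AdaptedFrame D r q₀)

theorem dualFiberCoord_dualMk (z : EuclideanSpace ℝ (Fin n) × CotangentModel r) :
    dualFiberCoord q₀ (A.dualMk z) = z.2 ∘L A.pr ∘L coordFrame D r q₀ z.1 := by
  rw [dualFiberCoord_apply]
  rfl

omit [VectorBundle ℝ (EuclideanSpace ℝ (Fin r)) (fun q : Q => D q)] in
theorem exists_dualMk_eq {x : EuclideanSpace ℝ (Fin n)} (hx : x ∈ A.U)
    (β : D ((extChartAt (𝓡 n) q₀).symm x) →L[ℝ] ℝ) :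
    ∃ p, A.dualMk (x, p) = ⟨(extChartAt (𝓡 n) q₀).symm x, β⟩ := by
  refine ⟨β ∘L (chartDifferentialSymm q₀ _ ∘L A.B x).codRestrict
    (D ((extChartAt (𝓡 n) q₀).symm x)) (A.chartDifferentialSymm_B_mem hx), ?_⟩
  refine congrArg (TotalSpace.mk' (CotangentModel r) (E := fun q : Q => D q →L[ℝ] ℝ)
    ((extChartAt (𝓡 n) q₀).symm x)) ?_
  ext w
  refine congrArg β (Subtype.ext ?_)
  exact (congrArg (chartDifferentialSymm q₀ _) (A.B_pr_chartDifferential hx w)).trans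
    (chartDifferentialSymm_apply_chartDifferential (A.mem_source hx) _)

omit [VectorBundle ℝ (EuclideanSpace ℝ (Fin r)) (fun q : Q => D q)] in
theorem exists_dualMk_eq_of_proj_eq (α : DualDistribution r D) (hα : α.proj = q₀) :
    ∃ p, A.dualMk (extChartAt (𝓡 n) q₀ q₀, p) = α := by
  obtain ⟨q, a⟩ := α
  subst hα
  -- Quantifying over `β` lets the base point be rewritten although the fibre depends on it.
  have h : ∃ β : D ((extChartAt (𝓡 n) q).symm (extChartAt (𝓡 n) q q)) →L[ℝ] ℝ,
      (⟨(extChartAt (𝓡 n) q).symm (extChartAt (𝓡 n) q q), β⟩ : DualDistribution r D) = ⟨q, a⟩ := by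
    rw [extChartAt_to_inv]
    exact ⟨a, rfl⟩
  obtain ⟨β, hβ⟩ := h
  obtain ⟨p, hp⟩ := A.exists_dualMk_eq A.mem_U β
  exact ⟨p, hp.trans hβ⟩

/-- This is the change of frame between the bundle trivialization and the adapted frame; through it
smoothness on `D*` is compared in the two sets of fibre coordinates. -/
theorem isUnit_pr_comp_coordFrame {x : EuclideanSpace ℝ (Fin n)} (hx : x ∈ A.U) :
    IsUnit (A.pr ∘L coordFrame D r q₀ x) := by
  rw [ContinuousLinearMap.isUnit_iff_bijective]
  have hinj : Function.Injective (A.pr ∘L coordFrame D r q₀ x).toLinearMap := by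
    rw [injective_iff_map_eq_zero]
    intro v hv
    have hv' : A.pr (coordFrame D r q₀ x v) = 0 := hv
    have h1 : A.B x (A.pr (coordFrame D r q₀ x v)) = coordFrame D r q₀ x v :=
      A.B_pr_chartDifferential hx _
    rw [hv', map_zero] at h1
    exact coordFrame_injective D (A.U_subset hx) (h1.symm.trans (map_zero _).symm)
  exact ⟨hinj, LinearMap.injective_iff_surjective.1 hinj⟩

variable [ContMDiffVectorBundle ∞ (EuclideanSpace ℝ (Fin r)) (fun q : Q => D q) (𝓡 n)]
  (hD : ContMDiff ((𝓡 n).prod (𝓡 r)) (𝓡 n).tangent ∞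
      (fun v : TotalSpace (EuclideanSpace ℝ (Fin r)) (fun q : Q => D q) =>
        (⟨v.proj, (v.2 : TangentSpace (𝓡 n) v.proj)⟩ : TangentBundle (𝓡 n) Q)))

include hD

theorem contDiffAt_coordFrame {x : EuclideanSpace ℝ (Fin n)} (hx : x ∈ A.U) :
    ContDiffAt ℝ ∞ (coordFrame D r q₀) x :=
  (contDiffOn_coordFrame D hD q₀).contDiffAt
    ((isOpen_coordFrameDomain D q₀).mem_nhds (A.U_subset hx))

theorem contMDiffAt_dualMk {z : EuclideanSpace ℝ (Fin n) × CotangentModel r} (hz : z.1 ∈ A.U) :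
    ContMDiffAt 𝓘(ℝ, EuclideanSpace ℝ (Fin n) × CotangentModel r)
      ((𝓡 n).prod 𝓘(ℝ, CotangentModel r)) ∞ A.dualMk z := by
  refine ((trivializationAt (CotangentModel r) (fun q : Q => D q →L[ℝ] ℝ) q₀).contMDiffAt_iff
    (mem_dualTrivialization_source (β := A.dualMk z) (A.U_subset hz).2)).2 ⟨?_, ?_⟩
  · exact ((contMDiffOn_extChartAt_symm q₀).contMDiffAt ((isOpen_extChartAt_target q₀).mem_nhds
      (A.mem_target hz))).comp z contDiffAt_fst.contMDiffAt
  · have h : ContDiffAt ℝ ∞ (fun z : EuclideanSpace ℝ (Fin n) × CotangentModel r =>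
        z.2 ∘L A.pr ∘L coordFrame D r q₀ z.1) z :=
      contDiffAt_snd.clm_comp (contDiffAt_const.clm_comp
        ((A.contDiffAt_coordFrame hD hz).comp z contDiffAt_fst))
    exact h.contMDiffAt.congr_of_eventuallyEq (Eventually.of_forall A.dualFiberCoord_dualMk)

theorem contDiffAt_comp_dualMk {φ : DualDistribution r D → ℝ}
    (hφ : ContMDiff ((𝓡 n).prod 𝓘(ℝ, CotangentModel r)) 𝓘(ℝ, ℝ) ∞ φ)
    {z : EuclideanSpace ℝ (Fin n) × CotangentModel r} (hz : z.1 ∈ A.U) :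
    ContDiffAt ℝ ∞ (φ ∘ A.dualMk) z := by
  rw [← contMDiffAt_iff_contDiffAt]
  exact (hφ _).comp z (A.contMDiffAt_dualMk hD hz)

/-- The coordinate formula for the inner bracket holds on a neighbourhood and its right side is
smooth there, so the formula may be applied a second time. -/
theorem nonholonomicBracket_nonholonomicBracket_dualMk {φ ψ μ : DualDistribution r D → ℝ}
    (hφ : ContMDiff ((𝓡 n).prod 𝓘(ℝ, CotangentModel r)) 𝓘(ℝ, ℝ) ∞ φ)
    (hψ : ContMDiff ((𝓡 n).prod 𝓘(ℝ, CotangentModel r)) 𝓘(ℝ, ℝ) ∞ ψ)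
    (hμ : ContMDiff ((𝓡 n).prod 𝓘(ℝ, CotangentModel r)) 𝓘(ℝ, ℝ) ∞ μ)
    {z : EuclideanSpace ℝ (Fin n) × CotangentModel r} (hz : z.1 ∈ A.U) :
    nonholonomicBracket g D (nonholonomicBracket g D φ ψ) μ (A.dualMk z) =
      frameBracket A.B (A.projCoord g)
        (frameBracket A.B (A.projCoord g) (φ ∘ A.dualMk) (ψ ∘ A.dualMk)) (μ ∘ A.dualMk) z := by
  have h1 : nonholonomicBracket g D φ ψ ∘ A.dualMk =ᶠ[𝓝 z]
      frameBracket A.B (A.projCoord g) (φ ∘ A.dualMk) (ψ ∘ A.dualMk) := by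
    filter_upwards [continuousAt_fst.eventually (A.isOpen_U.eventually_mem hz)] with y hy
    exact A.nonholonomicBracket_dualMk g hy
      ((A.contDiffAt_comp_dualMk hD hφ hy).differentiableAt (by simp))
      ((A.contDiffAt_comp_dualMk hD hψ hy).differentiableAt (by simp))
  have h2 : ContDiffAt ℝ ∞ (frameBracket A.B (A.projCoord g) (φ ∘ A.dualMk) (ψ ∘ A.dualMk)) z :=
    contDiffAt_frameBracket (A.contDiffAt_B hz)
      ((A.contDiffOn_projCoord g).contDiffAt (A.isOpen_U.mem_nhds hz))
      (A.contDiffAt_comp_dualMk hD hφ hz) (A.contDiffAt_comp_dualMk hD hψ hz)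
  rw [A.nonholonomicBracket_dualMk g hz
    ((h2.congr_of_eventuallyEq h1).differentiableAt (by simp))
    ((A.contDiffAt_comp_dualMk hD hμ hz).differentiableAt (by simp))]
  exact (frameBracket_congr h1 EventuallyEq.rfl).self_of_nhds

/-- Globally defined smooth functions on `D*` that agree, near the fibre over `q₀`, with the linear
functions in the adapted coordinates. -/
theorem exists_contMDiff_eventuallyEq [T2Space Q] :
    ∃ V : Set (EuclideanSpace ℝ (Fin n)), IsOpen V ∧ extChartAt (𝓡 n) q₀ q₀ ∈ V ∧ V ⊆ A.U ∧
      (∀ v, ∃ φ : DualDistribution r D → ℝ,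
        ContMDiff ((𝓡 n).prod 𝓘(ℝ, CotangentModel r)) 𝓘(ℝ, ℝ) ∞ φ ∧
          ∀ z, z.1 ∈ V → φ (A.dualMk z) = z.2 v) ∧
      (∀ l : EuclideanSpace ℝ (Fin n) →L[ℝ] ℝ, ∃ φ : DualDistribution r D → ℝ,
        ContMDiff ((𝓡 n).prod 𝓘(ℝ, CotangentModel r)) 𝓘(ℝ, ℝ) ∞ φ ∧
          ∀ z, z.1 ∈ V → φ (A.dualMk z) = l z.1) := by
  set W : Set Q := (extChartAt (𝓡 n) q₀).source ∩ extChartAt (𝓡 n) q₀ ⁻¹' A.U with hW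
  have hWo : IsOpen W := isOpen_extChartAt_preimage' q₀ A.isOpen_U
  have hqW : q₀ ∈ W := ⟨mem_extChartAt_source q₀, A.mem_U⟩
  -- A bump function on the base suffices: its pullback to `D*` is supported over `W`, where the
  -- coordinate functions are smooth.
  obtain ⟨ρ, -, hρW⟩ := (SmoothBumpFunction.nhds_basis_tsupport (I := 𝓡 n) q₀).mem_iff.1
    (hWo.mem_nhds hqW)
  have hρ : ContMDiff (𝓡 n) 𝓘(ℝ, ℝ) ∞ ρ := ρ.contMDiff
  have hcut : ∀ ℓ : DualDistribution r D → ℝ, (∀ β : DualDistribution r D, β.proj ∈ W →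
      ContMDiffAt ((𝓡 n).prod 𝓘(ℝ, CotangentModel r)) 𝓘(ℝ, ℝ) ∞ ℓ β) →
      ContMDiff ((𝓡 n).prod 𝓘(ℝ, CotangentModel r)) 𝓘(ℝ, ℝ) ∞ (fun β => ρ β.proj * ℓ β) := by
    intro ℓ hℓ
    have hproj : ContMDiff ((𝓡 n).prod 𝓘(ℝ, CotangentModel r)) (𝓡 n) ∞
        (fun β : DualDistribution r D => β.proj) := contMDiff_proj _
    refine contMDiff_of_tsupport fun β hβ => ?_
    have hβρ : β.proj ∈ tsupport ρ := by
      have hcl : IsClosed ((fun β : DualDistribution r D => β.proj) ⁻¹' tsupport ρ) :=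
        (isClosed_tsupport _).preimage hproj.continuous
      have hsub : Function.support (fun β : DualDistribution r D => ρ β.proj * ℓ β) ⊆
          (fun β : DualDistribution r D => β.proj) ⁻¹' tsupport ρ :=
        fun γ hγ => subset_tsupport _ (left_ne_zero_of_mul hγ)
      exact closure_minimal hsub hcl hβ
    exact ((hρ _).comp β (hproj β)).mul (hℓ β (hρW hβρ))
  obtain ⟨V', hV'1, hV'o, hV'q⟩ := eventually_nhds_iff.1 ρ.eventuallyEq_one
  set V := A.U ∩ (extChartAt (𝓡 n) q₀).symm ⁻¹' V' with hV
  have hVo : IsOpen V := by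
    refine ContinuousOn.isOpen_inter_preimage ?_ A.isOpen_U hV'o
    exact (continuousOn_extChartAt_symm q₀).mono fun x hx => A.mem_target hx
  have hρ1 : ∀ x ∈ V, ρ ((extChartAt (𝓡 n) q₀).symm x) = 1 := fun x hx => hV'1 _ hx.2
  have hext : ∀ β : DualDistribution r D, β.proj ∈ W →
      ContMDiffAt ((𝓡 n).prod 𝓘(ℝ, CotangentModel r)) (𝓡 n) ∞
        (fun β : DualDistribution r D => extChartAt (𝓡 n) q₀ β.proj) β := by
    intro β hβ
    have hs := hβ.1
    rw [extChartAt_source] at hs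
    exact (contMDiffAt_extChartAt' hs).comp β (contMDiffAt_proj _)
  refine ⟨V, hVo, ⟨A.mem_U, by rw [mem_preimage, extChartAt_to_inv]; exact hV'q⟩,
    inter_subset_left, fun v => ?_, fun l => ?_⟩
  -- Fibre coordinates in the trivialization are `p ∘ pr ∘ frame`, so evaluating them at `(pr ∘
  -- frame)⁻¹ v` recovers `p v`.
  · refine ⟨_, hcut (fun β => dualFiberCoord q₀ β
      (Ring.inverse (A.pr ∘L coordFrame D r q₀ (extChartAt (𝓡 n) q₀ β.proj)) v)) ?_, ?_⟩
    · intro β hβ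
      have hβs : β.proj ∈ (trivializationAt (EuclideanSpace ℝ (Fin r))
          (fun q : Q => D q) q₀).baseSet := by
        have := (A.U_subset hβ.2).2
        rwa [mem_preimage, (extChartAt (𝓡 n) q₀).left_inv hβ.1] at this
      have h1 : ContMDiffAt ((𝓡 n).prod 𝓘(ℝ, CotangentModel r)) 𝓘(ℝ, CotangentModel r) ∞
          (dualFiberCoord q₀ : DualDistribution r D → _) β :=
        (((trivializationAt (CotangentModel r) (fun q : Q => D q →L[ℝ] ℝ) q₀).contMDiffAt_iff
          (f := id) (mem_dualTrivialization_source hβs)).1 contMDiffAt_id).2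
      have h2 : ContDiffAt ℝ ∞ (fun x => Ring.inverse (A.pr ∘L coordFrame D r q₀ x) v)
          (extChartAt (𝓡 n) q₀ β.proj) := by
        refine ContDiffAt.clm_apply ?_ contDiffAt_const
        obtain ⟨u, hu⟩ := A.isUnit_pr_comp_coordFrame hβ.2
        have h3 : ContDiffAt ℝ ∞ Ring.inverse
            (A.pr ∘L coordFrame D r q₀ (extChartAt (𝓡 n) q₀ β.proj)) := by
          rw [← hu]; exact contDiffAt_ringInverse ℝ u
        have h4 : ContDiffAt ℝ ∞ (fun x => A.pr ∘L coordFrame D r q₀ x)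
            (extChartAt (𝓡 n) q₀ β.proj) :=
          contDiffAt_const.clm_comp (A.contDiffAt_coordFrame hD hβ.2)
        exact ContDiffAt.comp (extChartAt (𝓡 n) q₀ β.proj)
          (f := fun x => A.pr ∘L coordFrame D r q₀ x) h3 h4
      exact h1.clm_apply (h2.contMDiffAt.comp β (hext β hβ))
    · intro z hz
      have h1 : (A.dualMk z).proj = (extChartAt (𝓡 n) q₀).symm z.1 := rfl
      simp only [h1, hρ1 z.1 hz, one_mul, dualFiberCoord_dualMk,
        (extChartAt (𝓡 n) q₀).right_inv (A.mem_target hz.1)]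
      exact congrArg z.2 (DFunLike.congr_fun
        (Ring.mul_inverse_cancel _ (A.isUnit_pr_comp_coordFrame hz.1)) v)
  · refine ⟨_, hcut (fun β => l (extChartAt (𝓡 n) q₀ β.proj)) ?_, ?_⟩
    · intro β hβ
      exact l.contMDiff.contMDiffAt.comp β (hext β hβ)
    · intro z hz
      have h1 : (A.dualMk z).proj = (extChartAt (𝓡 n) q₀).symm z.1 := rfl
      simp only [h1, hρ1 z.1 hz, one_mul,
        (extChartAt (𝓡 n) q₀).right_inv (A.mem_target hz.1)]

end AdaptedFrame

end DualCoordinates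

/-! ### Integral manifolds versus vanishing torsion. -/

section Main

open Filter
open scoped Topology

variable {n r : ℕ} {Q : Type*} [TopologicalSpace Q] [ChartedSpace (EuclideanSpace ℝ (Fin n)) Q]
  [IsManifold (𝓡 n) ∞ Q]

theorem fderiv_extChartAt_comp_apply {q₀ : Q} {f : EuclideanSpace ℝ (Fin r) → Q}
    {u : EuclideanSpace ℝ (Fin r)} (hf : MDifferentiableAt (𝓡 r) (𝓡 n) f u)
    (hu : f u ∈ (extChartAt (𝓡 n) q₀).source) (h : EuclideanSpace ℝ (Fin r)) :
    fderiv ℝ (extChartAt (𝓡 n) q₀ ∘ f) u h =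
      chartDifferential q₀ (f u) (mfderiv (𝓡 r) (𝓡 n) f u h) := by
  have hu' := hu
  rw [extChartAt_source] at hu'
  rw [chartDifferential_eq_mfderiv hu, ← mfderiv_eq_fderiv,
    mfderiv_comp u (mdifferentiableAt_extChartAt hu') hf]
  rfl

variable {D : ∀ q : Q, Submodule ℝ (TangentSpace (𝓡 n) q)}
  [TopologicalSpace (TotalSpace (EuclideanSpace ℝ (Fin r)) (fun q : Q => D q))]
  [FiberBundle (EuclideanSpace ℝ (Fin r)) (fun q : Q => D q)]

namespace AdaptedFrame

variable {q₀ : Q} (A : AdaptedFrame D r q₀)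

theorem mem_iff_of_mem_source {q : Q} (hq : q ∈ (extChartAt (𝓡 n) q₀).source)
    (hq' : extChartAt (𝓡 n) q₀ q ∈ A.U) (w : TangentSpace (𝓡 n) q) :
    w ∈ D q ↔ chartDifferential q₀ q w ∈
      LinearMap.range (A.B (extChartAt (𝓡 n) q₀ q)).toLinearMap := by
  have h := A.mem_iff _ hq'
  rw [(extChartAt (𝓡 n) q₀).left_inv hq] at h
  exact h w

theorem frameTorsion_eq_zero_of_isIntegrableDistribution (h : IsIntegrableDistribution r D)
    {x : EuclideanSpace ℝ (Fin n)} (hx : x ∈ A.U) (v w : EuclideanSpace ℝ (Fin r)) :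
    frameTorsion A.B x v w = 0 := by
  -- The integral manifold is taken through the point with coordinates `x`, not through `q₀`, so the
  -- torsion vanishes on all of `A.U`.
  obtain ⟨W, f, hW, ⟨u₀, hu₀, hfu₀⟩, hf, -, hfW⟩ := h ((extChartAt (𝓡 n) q₀).symm x)
  have hxs := A.mem_source hx
  have hfx : (extChartAt (𝓡 n) q₀ ∘ f) u₀ = x := by
    rw [Function.comp_apply, hfu₀, (extChartAt (𝓡 n) q₀).right_inv (A.mem_target hx)]
  have hfu : ∀ u ∈ W, ContMDiffAt (𝓡 r) (𝓡 n) ∞ f u := fun u hu =>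
    hf.contMDiffAt (hW.mem_nhds hu)
  have hmd : ∀ u ∈ W, MDifferentiableAt (𝓡 r) (𝓡 n) f u := fun u hu =>
    (hfu u hu).mdifferentiableAt (by simp)
  have hs0 : f u₀ ∈ (extChartAt (𝓡 n) q₀).source := by rwa [hfu₀]
  have hc : ContDiffAt ℝ ∞ (extChartAt (𝓡 n) q₀ ∘ f) u₀ := by
    rw [← contMDiffAt_iff_contDiffAt]
    have hs0' := hs0
    rw [extChartAt_source] at hs0'
    exact (contMDiffAt_extChartAt' hs0').comp u₀ (hfu u₀ hu₀)
  have hs : ∀ᶠ u in 𝓝 u₀, u ∈ W ∧ f u ∈ (extChartAt (𝓡 n) q₀).source ∧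
      (extChartAt (𝓡 n) q₀ ∘ f) u ∈ A.U := by
    refine (hW.eventually_mem hu₀).and (((hfu u₀ hu₀).continuousAt.eventually
      ((isOpen_extChartAt_source q₀).eventually_mem hs0)).and
      (hc.continuousAt.eventually (A.isOpen_U.eventually_mem ?_)))
    rwa [hfx]
  rw [← hfx] at hx ⊢
  refine frameTorsion_eq_zero_of_integral (pr := A.pr) hc
    ((A.contDiffAt_B hx).differentiableAt (by simp)) ?_ ?_ ?_ v w
  · filter_upwards [A.isOpen_U.eventually_mem hx] with y hy using A.pr_B y hy
  · filter_upwards [hs] with u hu a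
    rw [fderiv_extChartAt_comp_apply (hmd u hu.1) hu.2.1]
    refine (A.mem_iff_of_mem_source hu.2.1 hu.2.2 _).1 ?_
    rw [← (hfW u hu.1).2]
    exact ⟨a, rfl⟩
  · intro a b hab
    rw [fderiv_extChartAt_comp_apply (hmd u₀ hu₀) hs0,
      fderiv_extChartAt_comp_apply (hmd u₀ hu₀) hs0] at hab
    refine (hfW u₀ hu₀).1 ?_
    rw [← chartDifferentialSymm_apply_chartDifferential hs0 (mfderiv (𝓡 r) (𝓡 n) f u₀ a), hab,
      chartDifferentialSymm_apply_chartDifferential hs0]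

/-- The local Frobenius theorem: an adapted frame whose torsion vanishes near `q₀` is tangent to an
integral manifold through `q₀`. -/
theorem exists_integral_manifold {V : Set (EuclideanSpace ℝ (Fin n))} (hV : IsOpen V)
    (hVU : V ⊆ A.U) (hq₀ : extChartAt (𝓡 n) q₀ q₀ ∈ V)
    (hT : ∀ x ∈ V, ∀ v w, frameTorsion A.B x v w = 0) :
    ∃ (W : Set (EuclideanSpace ℝ (Fin r))) (f : EuclideanSpace ℝ (Fin r) → Q),
      IsOpen W ∧ q₀ ∈ f '' W ∧ ContMDiffOn (𝓡 r) (𝓡 n) ∞ f W ∧ InjOn f W ∧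
      ∀ x ∈ W, Function.Injective (mfderiv (𝓡 r) (𝓡 n) f x) ∧
        LinearMap.range (mfderiv (𝓡 r) (𝓡 n) f x).toLinearMap = D (f x) := by
  obtain ⟨ε, hε, f, hf0, hf, hfV⟩ := exists_contDiffOn_hasFDerivAt_of_symmetric hV
    (A.contDiffOn_B.mono hVU) (fun x hx v w => sub_eq_zero.1 (hT x hx v w)) hq₀
  have hU : ∀ u ∈ Metric.ball 0 ε, f u ∈ A.U := fun u hu => hVU (hfV u hu).1
  have hmaps : MapsTo f (Metric.ball 0 ε) (extChartAt (𝓡 n) q₀).target := fun u hu =>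
    A.mem_target (hU u hu)
  have hF : ContMDiffOn (𝓡 r) (𝓡 n) ∞ ((extChartAt (𝓡 n) q₀).symm ∘ f) (Metric.ball 0 ε) :=
    (contMDiffOn_extChartAt_symm q₀).comp hf.contMDiffOn hmaps
  have hmf : ∀ u ∈ Metric.ball 0 ε, ∀ h, chartDifferential q₀ ((extChartAt (𝓡 n) q₀).symm (f u))
      (mfderiv (𝓡 r) (𝓡 n) ((extChartAt (𝓡 n) q₀).symm ∘ f) u h) = A.B (f u) h := by
    intro u hu h
    have hmd : MDifferentiableAt (𝓡 r) (𝓡 n) ((extChartAt (𝓡 n) q₀).symm ∘ f) u :=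
      (hF.contMDiffAt (Metric.isOpen_ball.mem_nhds hu)).mdifferentiableAt (by simp)
    have heq : extChartAt (𝓡 n) q₀ ∘ (extChartAt (𝓡 n) q₀).symm ∘ f =ᶠ[𝓝 u] f := by
      filter_upwards [Metric.isOpen_ball.mem_nhds hu] with y hy
      exact (extChartAt (𝓡 n) q₀).right_inv (hmaps hy)
    refine (fderiv_extChartAt_comp_apply hmd (A.mem_source (hU u hu)) h).symm.trans ?_
    rw [heq.fderiv_eq, (hfV u hu).2.fderiv]
  refine ⟨Metric.ball 0 ε, (extChartAt (𝓡 n) q₀).symm ∘ f, Metric.isOpen_ball,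
    ⟨0, Metric.mem_ball_self hε, ?_⟩, hF, ?_, fun u hu => ⟨?_, ?_⟩⟩
  · rw [Function.comp_apply, hf0, extChartAt_to_inv]
  -- Since `pr ∘ f' = pr ∘ B = id`, the map `pr ∘ f` is a translation on the ball; this gives
  -- injectivity on the whole ball.
  · have hpr : ∀ u ∈ Metric.ball 0 ε, A.pr (f u) = u + A.pr (f 0) := by
      intro u hu
      have hd : ∀ y ∈ Metric.ball (0 : EuclideanSpace ℝ (Fin r)) ε,
          HasFDerivAt (fun y => A.pr (f y) - y) (0 : EuclideanSpace ℝ (Fin r) →L[ℝ] _) y := by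
        intro y hy
        have h1 := (A.pr.hasFDerivAt.comp y (hfV y hy).2).sub (hasFDerivAt_id y)
        refine h1.congr_fderiv ?_
        ext1 v
        simp [A.pr_B _ (hU y hy)]
      have h2 := Metric.isOpen_ball.is_const_of_fderiv_eq_zero (𝕜 := ℝ)
        (convex_ball (0 : EuclideanSpace ℝ (Fin r)) ε).isPreconnected
        (fun y hy => (hd y hy).differentiableAt.differentiableWithinAt)
        (fun y hy => (hd y hy).fderiv) hu (Metric.mem_ball_self hε)
      simp only [sub_zero] at h2
      rw [← h2]; abel
    intro u hu v hv huv
    have h := (extChartAt (𝓡 n) q₀).symm.injOn (hmaps hu) (hmaps hv) huv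
    have h' := congrArg A.pr h
    rw [hpr u hu, hpr v hv] at h'
    exact add_right_cancel h'
  · intro a b hab
    have h := congrArg (chartDifferential q₀ ((extChartAt (𝓡 n) q₀).symm (f u))) hab
    rw [hmf u hu, hmf u hu] at h
    exact (A.pr_B _ (hU u hu) a).symm.trans ((congrArg A.pr h).trans (A.pr_B _ (hU u hu) b))
  · ext w
    refine Iff.trans ?_ (A.mem_iff _ (hU u hu) w).symm
    constructor
    · rintro ⟨a, rfl⟩
      exact ⟨a, (hmf u hu a).symm⟩
    · rintro ⟨a, ha⟩
      refine ⟨a, ?_⟩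
      have h := congrArg (chartDifferentialSymm q₀ ((extChartAt (𝓡 n) q₀).symm (f u)))
        ((hmf u hu a).trans ha)
      rwa [chartDifferentialSymm_apply_chartDifferential (A.mem_source (hU u hu)),
        chartDifferentialSymm_apply_chartDifferential (A.mem_source (hU u hu))] at h

end AdaptedFrame

end Main

/-! ### The two implications. -/

open Filter Topology in
theorem AdaptedFrame.frameTorsion_eq_zero_of_jacobi_identity {n r : ℕ} {Q : Type*}
    [TopologicalSpace Q] [T2Space Q]
    [ChartedSpace (EuclideanSpace ℝ (Fin n)) Q] [IsManifold (𝓡 n) ∞ Q]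
    (g : ContMDiffRiemannianMetric (𝓡 n) ∞ (EuclideanSpace ℝ (Fin n))
      (fun q : Q => TangentSpace (𝓡 n) q))
    {D : ∀ q : Q, Submodule ℝ (TangentSpace (𝓡 n) q)}
    [TopologicalSpace (TotalSpace (EuclideanSpace ℝ (Fin r)) (fun q : Q => D q))]
    [FiberBundle (EuclideanSpace ℝ (Fin r)) (fun q : Q => D q)]
    [VectorBundle ℝ (EuclideanSpace ℝ (Fin r)) (fun q : Q => D q)]
    [ContMDiffVectorBundle ∞ (EuclideanSpace ℝ (Fin r)) (fun q : Q => D q) (𝓡 n)]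
    (hD : ContMDiff ((𝓡 n).prod (𝓡 r)) (𝓡 n).tangent ∞
      (fun v : TotalSpace (EuclideanSpace ℝ (Fin r)) (fun q : Q => D q) =>
        (⟨v.proj, (v.2 : TangentSpace (𝓡 n) v.proj)⟩ : TangentBundle (𝓡 n) Q)))
    {q₀ : Q} (A : AdaptedFrame D r q₀)
    (hJ : ∀ φ ψ μ : DualDistribution r D → ℝ,
      ContMDiff ((𝓡 n).prod 𝓘(ℝ, CotangentModel r)) 𝓘(ℝ, ℝ) ∞ φ →
      ContMDiff ((𝓡 n).prod 𝓘(ℝ, CotangentModel r)) 𝓘(ℝ, ℝ) ∞ ψ →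
      ContMDiff ((𝓡 n).prod 𝓘(ℝ, CotangentModel r)) 𝓘(ℝ, ℝ) ∞ μ →
      ∀ α : DualDistribution r D,
        nonholonomicBracket g D (nonholonomicBracket g D φ ψ) μ α
          + nonholonomicBracket g D (nonholonomicBracket g D μ φ) ψ α
          + nonholonomicBracket g D (nonholonomicBracket g D ψ μ) φ α = 0) :
    ∃ V : Set (EuclideanSpace ℝ (Fin n)), IsOpen V ∧ extChartAt (𝓡 n) q₀ q₀ ∈ V ∧ V ⊆ A.U ∧
      ∀ x ∈ V, ∀ v w, frameTorsion A.B x v w = 0 := by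
  -- `V` is fixed before `u`, `v` and `l`, so a single neighbourhood serves all test functions.
  obtain ⟨V, hV, hq₀, hVU, hlin, hbase⟩ := A.exists_contMDiff_eventuallyEq hD
  refine ⟨V, hV, hq₀, hVU, fun x hx v u => ?_⟩
  have hxU := hVU hx
  refine frameTorsion_eq_zero_of_jacobi (C := A.projCoord g) (pr := A.pr) (A.contDiffAt_B hxU)
    (((A.contDiffOn_projCoord g).contDiffAt (A.isOpen_U.mem_nhds hxU)).differentiableAt (by simp))
    ?_ fun l => ?_
  · filter_upwards [A.isOpen_U.eventually_mem hxU] with y hy using A.pr_B y hy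
  obtain ⟨φ, hφ, hφV⟩ := hlin u
  obtain ⟨ψ, hψ, hψV⟩ := hlin v
  obtain ⟨μ, hμ, hμV⟩ := hbase l
  have hn : ∀ᶠ z in 𝓝 ((x, 0) : EuclideanSpace ℝ (Fin n) × CotangentModel r), z.1 ∈ V :=
    continuousAt_fst.eventually (hV.eventually_mem hx)
  have hφ' : φ ∘ A.dualMk =ᶠ[𝓝 (x, 0)] fun z => z.2 u := hn.mono hφV
  have hψ' : ψ ∘ A.dualMk =ᶠ[𝓝 (x, 0)] fun z => z.2 v := hn.mono hψV
  have hμ' : μ ∘ A.dualMk =ᶠ[𝓝 (x, 0)] fun z => l z.1 := hn.mono hμV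
  have h := hJ φ ψ μ hφ hψ hμ (A.dualMk (x, 0))
  rw [A.nonholonomicBracket_nonholonomicBracket_dualMk g hD hφ hψ hμ hxU,
    A.nonholonomicBracket_nonholonomicBracket_dualMk g hD hμ hφ hψ hxU,
    A.nonholonomicBracket_nonholonomicBracket_dualMk g hD hψ hμ hφ hxU,
    (frameBracket_congr (frameBracket_congr hφ' hψ') hμ').self_of_nhds,
    (frameBracket_congr (frameBracket_congr hμ' hφ') hψ').self_of_nhds,
    (frameBracket_congr (frameBracket_congr hψ' hμ') hφ').self_of_nhds] at h
  exact h

theorem mainTheorem9 {n r : ℕ}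
    -- the configuration manifold `Q`, smooth of dimension `n`, with its kinetic energy metric `g`
    {Q : Type*} [TopologicalSpace Q] [T2Space Q] [SecondCountableTopology Q]
    [ChartedSpace (EuclideanSpace ℝ (Fin n)) Q] [IsManifold (𝓡 n) ∞ Q]
    (g : ContMDiffRiemannianMetric (𝓡 n) ∞ (EuclideanSpace ℝ (Fin n))
      (fun q : Q => TangentSpace (𝓡 n) q))
    -- `D ⊂ TQ` is a vector subbundle of rank `r`: a family of subspaces `D q` of the tangent spaces,
    -- with a structure of smooth vector bundle for which the inclusion into `TQ` is smooth
    (D : ∀ q : Q, Submodule ℝ (TangentSpace (𝓡 n) q))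
    [TopologicalSpace (TotalSpace (EuclideanSpace ℝ (Fin r)) (fun q : Q => D q))]
    [FiberBundle (EuclideanSpace ℝ (Fin r)) (fun q : Q => D q)]
    [VectorBundle ℝ (EuclideanSpace ℝ (Fin r)) (fun q : Q => D q)]
    [ContMDiffVectorBundle ∞ (EuclideanSpace ℝ (Fin r)) (fun q : Q => D q) (𝓡 n)]
    (hD : ContMDiff ((𝓡 n).prod (𝓡 r)) (𝓡 n).tangent ∞
      (fun v : TotalSpace (EuclideanSpace ℝ (Fin r)) (fun q : Q => D q) =>
        (⟨v.proj, (v.2 : TangentSpace (𝓡 n) v.proj)⟩ : TangentBundle (𝓡 n) Q))) :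
    -- the Jacobi identity for the nonholonomic bracket on `C^∞(D*)`
    (∀ φ ψ μ : DualDistribution r D → ℝ,
      ContMDiff ((𝓡 n).prod 𝓘(ℝ, CotangentModel r)) 𝓘(ℝ, ℝ) ∞ φ →
      ContMDiff ((𝓡 n).prod 𝓘(ℝ, CotangentModel r)) 𝓘(ℝ, ℝ) ∞ ψ →
      ContMDiff ((𝓡 n).prod 𝓘(ℝ, CotangentModel r)) 𝓘(ℝ, ℝ) ∞ μ →
      ∀ α : DualDistribution r D,
        nonholonomicBracket g D (nonholonomicBracket g D φ ψ) μ α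
          + nonholonomicBracket g D (nonholonomicBracket g D μ φ) ψ α
          + nonholonomicBracket g D (nonholonomicBracket g D ψ μ) φ α = 0) ↔
    IsIntegrableDistribution r D := by
  constructor
  · intro hJ q
    obtain ⟨A⟩ := nonempty_adaptedFrame D hD q
    obtain ⟨V, hV, hq, hVU, hT⟩ := A.frameTorsion_eq_zero_of_jacobi_identity g hD hJ
    exact A.exists_integral_manifold hV hVU hq hT
  · intro hI φ ψ μ hφ hψ hμ α
    obtain ⟨A⟩ := nonempty_adaptedFrame D hD α.proj
    -- The frame is centred at the base point of `α`, so `α` has adapted coordinates there.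
    obtain ⟨p, hp⟩ := A.exists_dualMk_eq_of_proj_eq α rfl
    have hx := A.mem_U
    rw [← hp, A.nonholonomicBracket_nonholonomicBracket_dualMk g hD hφ hψ hμ hx,
      A.nonholonomicBracket_nonholonomicBracket_dualMk g hD hμ hφ hψ hx,
      A.nonholonomicBracket_nonholonomicBracket_dualMk g hD hψ hμ hφ hx]
    refine frameBracket_jacobi ((A.contDiffAt_B hx).differentiableAt (by simp)) ?_
      (A.contDiffAt_comp_dualMk hD hφ hx) (A.contDiffAt_comp_dualMk hD hψ hx)
      (A.contDiffAt_comp_dualMk hD hμ hx)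
    filter_upwards [A.isOpen_U.eventually_mem hx] with x hx
    exact A.frameTorsion_eq_zero_of_isIntegrableDistribution hI hx
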